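/- Let $*$ be a nonstandard extension, i.e. an assignment $X \mapsto {^*X}$, $f \mapsto {^*f}$ on sets and functions (in particular also on power sets, function sets, etc.) which satisfies the Transfer Principle. Internal sets are the members ${^*Y}_b$, $b \in {^*I}$, of extensions of families of sets $(Y_i)_{i \in I}$. Let $B$ be an internal Dedekind ring, i.e. the member $B = {^*A}_b$ of the extension of a family of commutative rings $(A_i)_{i\in I}$ at an element $b \in {^*I}$ lying in the extension of $\{ i \in I : A_i \text{ is a Dedekind domain, not a field}\}$. Let $L$ be the quotient field of $B$. Let $\mathcal{M}$ be the set of internal maximal ideals of $B$ and let $\mathcal{L}$ be the lattice of hyperfinite subsets of $\mathcal{M}$. The group of internal Weil divisors ${^*\bigoplus}_{\mathcal{M}} {^*\mathbb{Z}}$ is the group of internal functions $\mathcal{M} \to {^*\mathbb{Z}}$ which vanish outside a hyperfinite subset of $\mathcal{M}$. For $a \in B$ put $V(a) = \{\mathfrak{p} \in \mathcal{M} : a \in \mathfrak{p}\}$. For a filter $\mathcal{F}$ on $\mathcal{L}$, let $\left({^*\bigoplus}_{\mathcal{M}} {^*\mathbb{Z}}\right)/\mathcal{F}$ be the group of internal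 Weil divisors where two of them are identified if they coincide on a set belonging to $\mathcal{F}$, ordered by pointwise comparison on a set belonging to $\mathcal{F}$. Theorem. Let $\mathfrak{m}$ be a (not necessarily internal) maximal ideal of $B$. Then the localization $B_{\mathfrak{m}}$ is a valuation ring of $L$. The filter $\mathcal{F}$ on $\mathcal{L}$ generated by the sets $V(a)$, $0 \neq a \in \mathfrak{m}$ (that is, the set of all $H \in \mathcal{L}$ which contain $V(a_1) \cap \dots \cap V(a_n)$ for some $n \geq 1$ and nonzero $a_1, \dots, a_n \in \mathfrak{m}$) is an ultrafilter, i.e. a maximal proper filter on $\mathcal{L}$. The value group $G = L^{\times}/B_{\mathfrak{m}}^{\times}$ of $B_{\mathfrak{m}}$ (written additively, with $v(x) \geq 0$ if and only if $x \in B_{\mathfrak{m}}$) satisfies $$ G \cong \left( {^*\bigoplus}_{\mathcal{M}} {^*\mathbb{Z}} \right) / \ \mathcal{F} $$ as ordered groups. If $\mathfrak{m}$ is internal, then $\mathcal{F}$ is the principal ultrafilter generated by $\mathfrak{m}$, i.e. $\mathcal{F} = \{H \in \mathcal{L} : \mathfrak{m} \in H\}$, and $G \cong {^*\mathbb{Z}}$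 as ordered groups. -/

import Mathlib

universe u v

/-- A nonstandard extension `*`: every set `X` and every function `f : X → Y` gets an extension
`*X`, `*f : *X → *Y`, and the extension of sets and functions satisfies the Transfer Principle.

For `A ⊆ X` the subset `*A ⊆ *X` is the image of the extension of the inclusion.  Since any subset
of a (finite product of) set(s) is allowed as an atomic formula, Transfer for all formulas says that
`A ↦ *A` commutes with equality, negation, conjunction, substitution of terms and existential
quantification.  The fields below contain finite products, equality and negation; the remaining
clauses follow (`ext_inter`, `ext_preimage`, `ext_image`).  As power sets, sets of functions, sets of
finite subsets etc. are themselves sets, this covers higher-order statements. -/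
structure NonstandardExtension where
  /-- the extension `*X` of the set `X` -/
  obj : Type u → Type v
  /-- the extension `*f` of the function `f` -/
  map : ∀ {X Y : Type u}, (X → Y) → obj X → obj Y
  map_id : ∀ {X : Type u} (x : obj X), map id x = x
  map_comp : ∀ {X Y Z : Type u} (g : Y → Z) (f : X → Y) (x : obj X),
    map (g ∘ f) x = map g (map f x)
  nonempty_unit : Nonempty (obj PUnit.{u + 1})
  /-- `*(X × Y) = *X × *Y` -/
  pair_bijective : ∀ X Y : Type u,
    Function.Bijective (fun z : obj (X × Y) => (map Prod.fst z, map Prod.snd z))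
  /-- Transfer for equations: `*{a | f a = g a} = {x | *f x = *g x}` -/
  map_eq_map_iff : ∀ {X Y : Type u} (f g : X → Y) (x : obj X),
    map f x = map g x ↔ x ∈ Set.range (map (Subtype.val : {a // f a = g a} → X))
  /-- Transfer for negations: `*(X \ A) = *X \ *A` -/
  range_compl : ∀ {X : Type u} (A : Set X),
    Set.range (map (Subtype.val : {a // a ∉ A} → X)) =
      (Set.range (map (Subtype.val : {a // a ∈ A} → X)))ᶜ

namespace NonstandardExtension

variable (S : NonstandardExtension.{u, v})

/-- The extension `*A ⊆ *X` of a subset `A ⊆ X`. -/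
def ext {X : Type u} (A : Set X) : Set (S.obj X) :=
  Set.range (S.map (Subtype.val : {a // a ∈ A} → X))

section Basic

variable {S}

theorem map_injective {X Y : Type u} {f : X → Y} (hf : Function.Injective f) :
    Function.Injective (S.map f) := by
  intro x y h
  obtain ⟨p, hp⟩ := (S.pair_bijective X X).2 (x, y)
  obtain ⟨rfl, rfl⟩ : S.map Prod.fst p = x ∧ S.map Prod.snd p = y := by simpa using hp
  rw [← S.map_comp, ← S.map_comp, S.map_eq_map_iff] at h
  obtain ⟨q, rfl⟩ := h
  rw [← S.map_comp, ← S.map_comp]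
  congr 1
  funext a
  exact hf a.2

theorem mem_ext_of_forall {X : Type u} {A : Set X} (h : ∀ a, a ∈ A) (x : S.obj X) :
    x ∈ S.ext A :=
  ⟨S.map (fun a => ⟨a, h a⟩) x, by rw [← S.map_comp]; exact S.map_id x⟩

theorem map_mem_ext {X Y : Type u} {f : X → Y} {A : Set X} {C : Set Y}
    (h : ∀ a ∈ A, f a ∈ C) {x : S.obj X} (hx : x ∈ S.ext A) : S.map f x ∈ S.ext C := by
  obtain ⟨y, rfl⟩ := hx
  refine ⟨S.map (fun a => ⟨f a.1, h _ a.2⟩) y, ?_⟩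
  rw [← S.map_comp, ← S.map_comp]
  rfl

theorem ext_mono {X : Type u} {A C : Set X} (h : A ⊆ C) : S.ext A ⊆ S.ext C := by
  intro x hx
  simpa only [S.map_id] using map_mem_ext (f := id) h hx

theorem ext_compl {X : Type u} (A : Set X) : S.ext Aᶜ = (S.ext A)ᶜ := S.range_compl A

theorem ext_univ {X : Type u} : S.ext (Set.univ : Set X) = Set.univ :=
  Set.eq_univ_of_forall fun x => mem_ext_of_forall (fun _ => trivial) x

theorem ext_empty {X : Type u} : S.ext (∅ : Set X) = ∅ := by
  rw [← Set.compl_univ, ext_compl, ext_univ, Set.compl_univ]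

/-- Transfer for the substitution of terms. -/
theorem ext_preimage {X Y : Type u} (f : X → Y) (C : Set Y) :
    S.ext (f ⁻¹' C) = S.map f ⁻¹' S.ext C := by
  ext x
  refine ⟨fun hx => map_mem_ext (f := f) (fun _ h => h) hx, fun hx => ?_⟩
  by_contra hn
  have h1 : x ∈ S.ext (f ⁻¹' C)ᶜ := by rw [ext_compl]; exact hn
  have h2 : S.map f x ∈ S.ext Cᶜ := map_mem_ext (f := f) (fun _ h => h) h1
  rw [ext_compl] at h2
  exact h2 hx

/-- Transfer for conjunctions. -/
theorem ext_inter {X : Type u} (A C : Set X) : S.ext (A ∩ C) = S.ext A ∩ S.ext C := by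
  refine subset_antisymm (Set.subset_inter (ext_mono Set.inter_subset_left)
    (ext_mono Set.inter_subset_right)) ?_
  rintro _ ⟨⟨y, rfl⟩, hx⟩
  have hy : y ∈ S.ext ((Subtype.val : {a // a ∈ A} → X) ⁻¹' C) := by
    rw [ext_preimage]; exact hx
  exact map_mem_ext (f := Subtype.val) (C := A ∩ C) (fun a ha => And.intro a.2 ha) hy

theorem ext_union {X : Type u} (A C : Set X) : S.ext (A ∪ C) = S.ext A ∪ S.ext C := by
  rw [← compl_inj_iff, ← ext_compl, Set.compl_union, ext_inter, ext_compl, ext_compl,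
    Set.compl_union]

/-- Transfer for existential quantifiers. -/
theorem ext_image {X Y : Type u} (f : X → Y) (A : Set X) :
    S.ext (f '' A) = S.map f '' S.ext A := by
  refine subset_antisymm ?_ ?_
  · rintro _ ⟨y, rfl⟩
    choose g hg using fun a : {a // a ∈ f '' A} => a.2
    refine ⟨S.map g y, ?_, ?_⟩
    · exact map_mem_ext (A := Set.univ) (fun a _ => (hg a).1) (by rw [ext_univ]; trivial)
    · rw [← S.map_comp]
      congr 1
      funext a
      exact (hg a).2
  · rintro _ ⟨x, hx, rfl⟩
    exact map_mem_ext (C := f '' A) (fun a ha => Set.mem_image_of_mem f ha) hx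

end Basic

section Pair

/-- The identification `*(X × Y) = *X × *Y`. -/
noncomputable def pair {X Y : Type u} : S.obj (X × Y) ≃ S.obj X × S.obj Y :=
  Equiv.ofBijective _ (S.pair_bijective X Y)

/-- The extension `*f : *X × *Y → *Z` of a function of two variables. -/
noncomputable def map₂ {X Y Z : Type u} (f : X → Y → Z) (x : S.obj X) (y : S.obj Y) : S.obj Z :=
  S.map (fun p : X × Y => f p.1 p.2) (S.pair.symm (x, y))

/-- The element of `*X` given by an element of `X`. -/
noncomputable def const {X : Type u} (a : X) : S.obj X :=
  S.map (fun _ => a) S.nonempty_unit.some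

variable {S}

theorem pair_symm_map {W X Y : Type u} (g : W → X) (h : W → Y) (w : S.obj W) :
    S.pair.symm (S.map g w, S.map h w) = S.map (fun a => (g a, h a)) w := by
  rw [Equiv.symm_apply_eq]
  change _ = (S.map _ (S.map _ w), S.map _ (S.map _ w))
  rw [← S.map_comp, ← S.map_comp]
  rfl

theorem map₂_map_map {W X Y Z : Type u} (f : X → Y → Z) (g : W → X) (h : W → Y) (w : S.obj W) :
    S.map₂ f (S.map g w) (S.map h w) = S.map (fun a => f (g a) (h a)) w := by
  rw [map₂, pair_symm_map, ← S.map_comp]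
  rfl

theorem exists_pair {X Y : Type u} (x : S.obj X) (y : S.obj Y) :
    ∃ w : S.obj (X × Y), S.map Prod.fst w = x ∧ S.map Prod.snd w = y := by
  obtain ⟨w, hw⟩ := (S.pair_bijective X Y).2 (x, y)
  exact ⟨w, by simpa using hw⟩

theorem map_const_fun {W X : Type u} (a : X) (w : S.obj W) :
    S.map (fun _ => a) w = S.const a := by
  have h := (S.pair_bijective PUnit.{u + 1} PUnit.{u + 1}).2
    (S.map (fun _ => PUnit.unit) w, S.nonempty_unit.some)
  obtain ⟨z, hz⟩ := h
  obtain ⟨h1, h2⟩ : S.map Prod.fst z = S.map (fun _ => PUnit.unit) w ∧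
      S.map Prod.snd z = S.nonempty_unit.some := by simpa using hz
  have h3 : (Prod.fst : PUnit.{u + 1} × PUnit.{u + 1} → PUnit.{u + 1}) = Prod.snd := rfl
  rw [const, ← h2, ← h3, h1, ← S.map_comp]
  rfl

noncomputable instance {X : Type u} [AddCommGroup X] : AddCommGroup (S.obj X) :=
  letI : Add (S.obj X) := ⟨S.map₂ (· + ·)⟩
  letI : Zero (S.obj X) := ⟨S.const 0⟩
  letI : Neg (S.obj X) := ⟨S.map (fun a => -a)⟩
  have addm : ∀ {W : Type u} (f g : W → X) (w : S.obj W),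
      S.map f w + S.map g w = S.map (fun a => f a + g a) w := fun f g w => map₂_map_map _ f g w
  have zerom : ∀ {W : Type u} (w : S.obj W), (0 : S.obj X) = S.map (fun _ => 0) w :=
    fun w => (map_const_fun 0 w).symm
  have negm : ∀ {W : Type u} (f : W → X) (w : S.obj W),
      - S.map f w = S.map (fun a => - f a) w := fun f w => (S.map_comp _ f w).symm
  { add_assoc := by
      intro x y z
      obtain ⟨t, ht, rfl⟩ := exists_pair (S := S) x y
      obtain ⟨w, rfl, rfl⟩ := exists_pair (S := S) t z
      subst ht
      simp only [← S.map_comp, addm]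
      congr 1
      funext a
      exact add_assoc _ _ _
    zero_add := by
      intro x
      have := addm (fun _ => 0) id x
      rw [← zerom, S.map_id] at this
      rw [this]
      simp only [id_eq, zero_add]
      exact S.map_id x
    add_zero := by
      intro x
      have := addm id (fun _ => 0) x
      rw [← zerom, S.map_id] at this
      rw [this]
      simp only [id_eq, add_zero]
      exact S.map_id x
    add_comm := by
      intro x y
      obtain ⟨w, rfl, rfl⟩ := exists_pair (S := S) x y
      simp only [addm]
      congr 1
      funext a
      exact add_comm _ _
    neg_add_cancel := by
      intro x
      have := addm (fun a => -a) id x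
      rw [S.map_id] at this
      refine this.trans ?_
      rw [zerom x]
      congr 1
      funext a
      exact neg_add_cancel a
    nsmul := nsmulRec
    zsmul := zsmulRec }

/-- The extension of an order relation. -/
instance {X : Type u} [Preorder X] : Preorder (S.obj X) where
  le x y := S.pair.symm (x, y) ∈ S.ext {p : X × X | p.1 ≤ p.2}
  le_refl x := by
    have := pair_symm_map id id x
    rw [S.map_id] at this
    rw [this]
    exact map_mem_ext (A := Set.univ) (fun a _ => le_refl a) (by rw [ext_univ]; trivial)
  le_trans x y z := by
    obtain ⟨t, ht, rfl⟩ := exists_pair (S := S) x y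
    obtain ⟨w, rfl, rfl⟩ := exists_pair (S := S) t z
    subst ht
    simp only [← S.map_comp, pair_symm_map]
    intro h1 h2
    change w ∈ S.map _ ⁻¹' S.ext _ at h1 h2
    rw [← ext_preimage] at h1 h2
    have h3 : w ∈ S.ext _ ∩ S.ext _ := ⟨h1, h2⟩
    rw [← ext_inter] at h3
    refine map_mem_ext ?_ h3
    rintro a ⟨ha1, ha2⟩
    exact le_trans (show a.1.1 ≤ a.1.2 from ha1) ha2

theorem obj_add_def {X : Type u} [AddCommGroup X] (x y : S.obj X) :
    x + y = S.map₂ (· + ·) x y := rfl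

theorem obj_zero_def {X : Type u} [AddCommGroup X] : (0 : S.obj X) = S.const 0 := rfl

theorem obj_neg_def {X : Type u} [AddCommGroup X] (x : S.obj X) :
    -x = S.map (fun a => -a) x := rfl

end Pair

/-- The ordered group `*ℤ` of hyperintegers. -/
abbrev HyperInt : Type v := S.obj (ULift.{u} ℤ)

/-- The internal set `Y_b`: the family of sets `(Y i)_{i ∈ I}` extends to a family of internal sets
indexed by `*I`, and `Y_b` is its member at `b ∈ *I`.  (Every internal set arises in this way: it is
an element `b` of `*I` for a set `I` of sets; take for `Y` the tautological family.)  If `*` is an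
ultrapower and `b` is the class of a family `(i_n)`, then `Y_b` is the ultraproduct of the
`Y (i_n)`. -/
def Internal {I : Type u} (Y : I → Type u) (b : S.obj I) : Type v :=
  {y : S.obj (Σ i, Y i) // S.map Sigma.fst y = b}

namespace Internal

variable {S} {I : Type u} {b : S.obj I} {Y Z W T : I → Type u}

/-- The internal function `Y_b → Z_b` given by a family of functions. -/
def map (f : ∀ i, Y i → Z i) (y : Internal S Y b) : Internal S Z b :=
  ⟨S.map (fun p => ⟨p.1, f p.1 p.2⟩) y.1, by
    rw [← S.map_comp]; exact y.2⟩

/-- The internal element given by a family of elements. -/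
def const (c : ∀ i, Y i) : Internal S Y b :=
  ⟨S.map (fun i => ⟨i, c i⟩) b, by
    rw [← S.map_comp]; exact S.map_id b⟩

theorem map_map (g : ∀ i, Z i → W i) (f : ∀ i, Y i → Z i) (y : Internal S Y b) :
    map g (map f y) = map (fun i a => g i (f i a)) y :=
  Subtype.ext (by
    change S.map _ (S.map _ _) = _
    rw [← S.map_comp]; rfl)

theorem map_id (y : Internal S Y b) : map (fun _ a => a) y = y :=
  Subtype.ext (S.map_id y.1)

theorem map_const_fun (c : ∀ i, Z i) (y : Internal S Y b) :
    map (fun i _ => c i) y = const c := by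
  refine Subtype.ext ?_
  change S.map _ _ = S.map _ b
  conv_rhs => rw [← y.2, ← S.map_comp]
  rfl

theorem pair_bijective (Y Z : I → Type u) (b : S.obj I) : Function.Bijective
    (fun w : Internal S (fun i => Y i × Z i) b =>
      (map (fun _ p => p.1) w, map (fun _ p => p.2) w)) := by
  constructor
  · intro w w' h
    obtain ⟨h1, h2⟩ := Prod.mk.inj h
    replace h1 := congrArg Subtype.val h1
    replace h2 := congrArg Subtype.val h2
    refine Subtype.ext ?_
    let g : (Σ i, Y i × Z i) → (Σ i, Y i) × (Σ i, Z i) := fun p => (⟨p.1, p.2.1⟩, ⟨p.1, p.2.2⟩)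
    have hg : Function.Injective g := by
      rintro ⟨i, y, z⟩ ⟨j, y', z'⟩ h
      simp only [g, Prod.mk.injEq, Sigma.mk.injEq] at h
      obtain ⟨⟨rfl, h1⟩, -, h2⟩ := h
      cases h1
      cases h2
      rfl
    apply map_injective hg
    apply (S.pair_bijective _ _).1
    refine Prod.ext ?_ ?_
    · change S.map _ (S.map _ _) = S.map _ (S.map _ _)
      rw [← S.map_comp, ← S.map_comp]
      exact h1
    · change S.map _ (S.map _ _) = S.map _ (S.map _ _)
      rw [← S.map_comp, ← S.map_comp]
      exact h2
  · rintro ⟨⟨y, hy⟩, ⟨z, hz⟩⟩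
    obtain ⟨p, rfl, rfl⟩ := exists_pair (S := S) y z
    have h := hy.trans hz.symm
    rw [← S.map_comp, ← S.map_comp, S.map_eq_map_iff] at h
    obtain ⟨q, rfl⟩ := h
    let k : {a : (Σ i, Y i) × (Σ i, Z i) // (Sigma.fst ∘ Prod.fst) a = (Sigma.fst ∘ Prod.snd) a} →
        (Σ i, Y i × Z i) := fun a => ⟨a.1.1.1, a.1.1.2, cast (congrArg Z a.2.symm) a.1.2.2⟩
    refine ⟨⟨S.map k q, ?_⟩, ?_⟩
    · rw [← hy, ← S.map_comp, ← S.map_comp, ← S.map_comp]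
      rfl
    · refine Prod.ext (Subtype.ext ?_) (Subtype.ext ?_)
      · change S.map _ (S.map _ _) = S.map _ (S.map _ _)
        rw [← S.map_comp, ← S.map_comp]
        rfl
      · change S.map _ (S.map _ _) = S.map _ (S.map _ _)
        rw [← S.map_comp, ← S.map_comp]
        congr 1
        funext a
        obtain ⟨⟨⟨i, y⟩, ⟨j, z⟩⟩, e⟩ := a
        change i = j at e
        subst e
        rfl

/-- The identification `(Y × Z)_b = Y_b × Z_b`. -/
noncomputable def pair :
    Internal S (fun i => Y i × Z i) b ≃ Internal S Y b × Internal S Z b :=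
  Equiv.ofBijective _ (pair_bijective Y Z b)

theorem exists_pair (y : Internal S Y b) (z : Internal S Z b) :
    ∃ w : Internal S (fun i => Y i × Z i) b,
      map (fun _ p => p.1) w = y ∧ map (fun _ p => p.2) w = z := by
  obtain ⟨w, hw⟩ := (pair_bijective Y Z b).2 (y, z)
  exact ⟨w, by simpa using hw⟩

/-- The internal function `Y_b × Z_b → W_b` given by a family of functions. -/
noncomputable def map₂ (f : ∀ i, Y i → Z i → W i) (y : Internal S Y b) (z : Internal S Z b) :
    Internal S W b :=
  map (fun i p => f i p.1 p.2) (pair.symm (y, z))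

theorem pair_symm_map (g : ∀ i, T i → Y i) (h : ∀ i, T i → Z i) (w : Internal S T b) :
    pair.symm (map g w, map h w) = map (fun i a => (g i a, h i a)) w := by
  rw [Equiv.symm_apply_eq]
  change _ = (map _ (map _ w), map _ (map _ w))
  rw [map_map, map_map]

theorem map₂_map_map (f : ∀ i, Y i → Z i → W i) (g : ∀ i, T i → Y i) (h : ∀ i, T i → Z i)
    (w : Internal S T b) :
    map₂ f (map g w) (map h w) = map (fun i a => f i (g i a) (h i a)) w := by
  rw [map₂, pair_symm_map, map_map]

/-- The internal relation between `Y_b` and `Z_b` given by a family of relations. -/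
def Rel (R : ∀ i, Y i → Z i → Prop) (y : Internal S Y b) (z : Internal S Z b) : Prop :=
  (pair.symm (y, z)).1 ∈ S.ext {p : Σ i, Y i × Z i | R p.1 p.2.1 p.2.2}

theorem rel_map_map (R : ∀ i, Y i → Z i → Prop) (g : ∀ i, T i → Y i) (h : ∀ i, T i → Z i)
    (w : Internal S T b) :
    Rel R (map g w) (map h w) ↔ w.1 ∈ S.ext {p : Σ i, T i | R p.1 (g p.1 p.2) (h p.1 p.2)} := by
  rw [Rel, pair_symm_map]
  change _ ∈ S.map _ ⁻¹' S.ext _ ↔ _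
  rw [← ext_preimage]
  rfl

/-- An internal ring: the member at `b` of the extension of a family of rings. -/
noncomputable instance {A : I → Type u} [∀ i, CommRing (A i)] : CommRing (Internal S A b) :=
  letI : Add (Internal S A b) := ⟨map₂ fun _ x y => x + y⟩
  letI : Mul (Internal S A b) := ⟨map₂ fun _ x y => x * y⟩
  letI : Neg (Internal S A b) := ⟨map fun _ x => -x⟩
  letI : Zero (Internal S A b) := ⟨const fun _ => 0⟩
  letI : One (Internal S A b) := ⟨const fun _ => 1⟩
  have addm : ∀ {T : I → Type u} (f g : ∀ i, T i → A i) (w : Internal S T b),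
      map f w + map g w = map (fun i a => f i a + g i a) w :=
    fun f g w => map₂_map_map _ f g w
  have mulm : ∀ {T : I → Type u} (f g : ∀ i, T i → A i) (w : Internal S T b),
      map f w * map g w = map (fun i a => f i a * g i a) w :=
    fun f g w => map₂_map_map _ f g w
  have negm : ∀ {T : I → Type u} (f : ∀ i, T i → A i) (w : Internal S T b),
      - map f w = map (fun i a => - f i a) w := fun f w => map_map _ f w
  have zerom : ∀ {T : I → Type u} (w : Internal S T b),
      (0 : Internal S A b) = map (fun i _ => 0) w := fun w => (map_const_fun _ w).symm
  have onem : ∀ {T : I → Type u} (w : Internal S T b),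
      (1 : Internal S A b) = map (fun i _ => 1) w := fun w => (map_const_fun _ w).symm
  CommRing.ofMinimalAxioms
    (by
      intro x y z
      obtain ⟨t, ht, rfl⟩ := exists_pair x y
      obtain ⟨w, rfl, rfl⟩ := exists_pair t z
      subst ht
      simp only [map_map, addm, add_assoc])
    (by
      intro x
      have := addm (fun _ _ => 0) (fun _ a => a) x
      rw [← zerom, map_id] at this
      rw [this]
      simp only [zero_add, map_id])
    (by
      intro x
      have := addm (fun _ a => -a) (fun _ a => a) x
      rw [← negm, map_id] at this
      rw [this, zerom x]
      simp only [neg_add_cancel])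
    (by
      intro x y z
      obtain ⟨t, ht, rfl⟩ := exists_pair x y
      obtain ⟨w, rfl, rfl⟩ := exists_pair t z
      subst ht
      simp only [map_map, mulm, mul_assoc])
    (by
      intro x y
      obtain ⟨w, rfl, rfl⟩ := exists_pair x y
      simp only [mulm, mul_comm])
    (by
      intro x
      have := mulm (fun _ _ => 1) (fun _ a => a) x
      rw [← onem, map_id] at this
      rw [this]
      simp only [one_mul, map_id])
    (by
      intro x y z
      obtain ⟨t, ht, rfl⟩ := exists_pair x y
      obtain ⟨w, rfl, rfl⟩ := exists_pair t z
      subst ht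
      simp only [map_map, mulm, addm, mul_add])

/-- The element of `*Z` given by an element of the member at `b` of a constant family. -/
def toStar {Z : Type u} (z : Internal S (fun _ : I => Z) b) : S.obj Z :=
  S.map Sigma.snd z.1

end Internal

section Divisors

variable {I : Type u} (A : I → Type u) [∀ i, CommRing (A i)] (b : S.obj I)

/-- The internal ring `B = A_b` is an internal Dedekind ring: it is obtained by transfer of the
notion of Dedekind domain, i.e. `b` belongs to the extension of the set of indices `i` such that
`A i` is a Dedekind domain.  As usual, fields are not counted as Dedekind domains here. -/
def IsInternalDedekind : Prop :=
  b ∈ S.ext {i | IsDedekindDomain (A i) ∧ ¬ IsField (A i)}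

variable {S A b}

/-- The internal subset of `B` with code `c` (a member at `b` of the family of power sets of the
`A i`) is `T`. -/
def Codes (c : S.Internal (fun i => Set (A i)) b) (T : Set (S.Internal A b)) : Prop :=
  ∀ x, x ∈ T ↔ Internal.Rel (fun _ x s => x ∈ s) x c

/-- Internal subsets of `B`. -/
def IsInternal (T : Set (S.Internal A b)) : Prop :=
  ∃ c : S.Internal (fun i => Set (A i)) b, Codes c T

variable (S A b)

/-- The set `𝓜` of internal maximal ideals of `B`. -/
def InternalMaximal : Type v :=
  {m : Ideal (S.Internal A b) // m.IsMaximal ∧ IsInternal (m : Set (S.Internal A b))}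

variable {S A b}

/-- Hyperfinite subsets of `𝓜`: their elements are the elements of a member at `b` of the family
of sets of finite sets of subsets of the `A i`. -/
def IsHyperfinite (H : Set (S.InternalMaximal A b)) : Prop :=
  ∃ h : S.Internal (fun i => Finset (Set (A i))) b, ∀ p : S.InternalMaximal A b,
    p ∈ H ↔ ∃ c : S.Internal (fun i => Set (A i)) b,
      Codes c (p.1 : Set (S.Internal A b)) ∧ Internal.Rel (fun _ s t => s ∈ t) c h

/-- Internal functions `𝓜 → *ℤ`: they are given by a member at `b` of the family of sets of
functions from the subsets of `A i` to `ℤ`. -/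
def IsInternalFun (f : S.InternalMaximal A b → S.HyperInt) : Prop :=
  ∃ φ : S.Internal (fun i => Set (A i) → ULift.{u} ℤ) b, ∀ (p : S.InternalMaximal A b)
    (c : S.Internal (fun i => Set (A i)) b), Codes c (p.1 : Set (S.Internal A b)) →
      f p = (Internal.map₂ (fun _ ψ s => ψ s) φ c).toStar

theorem isHyperfinite_empty : IsHyperfinite (∅ : Set (S.InternalMaximal A b)) := by
  refine ⟨Internal.const fun _ => ∅, fun p => ⟨fun h => h.elim, ?_⟩⟩
  rintro ⟨c, -, hc⟩
  rw [← Internal.map_const_fun _ c] at hc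
  have h2 := Internal.map_id c
  rw [← h2, Internal.map_map, Internal.rel_map_map] at hc
  simp only [Finset.notMem_empty] at hc
  have : {p : Σ i, Set (A i) | False} = ∅ := rfl
  rw [this, ext_empty] at hc
  exact hc

theorem IsHyperfinite.union {H K : Set (S.InternalMaximal A b)} (hH : IsHyperfinite H)
    (hK : IsHyperfinite K) : IsHyperfinite (H ∪ K) := by
  classical
  obtain ⟨h, hh⟩ := hH
  obtain ⟨k, hk⟩ := hK
  refine ⟨Internal.map₂ (fun _ s t => s ∪ t) h k, fun p => ?_⟩
  rw [Set.mem_union, hh, hk, ← exists_or]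
  refine exists_congr fun c => ?_
  rw [← and_or_left]
  refine and_congr_right fun _ => ?_
  obtain ⟨t, ht, rfl⟩ := Internal.exists_pair h k
  obtain ⟨w, rfl, rfl⟩ := Internal.exists_pair t c
  subst ht
  simp only [Internal.map_map, Internal.map₂_map_map, Internal.rel_map_map, Finset.mem_union]
  rw [← Set.mem_union, ← ext_union]
  rfl

variable (S A b)

/-- The group `*⨁_𝓜 *ℤ` of internal Weil divisors of `B`: internal functions `𝓜 → *ℤ` that vanish
outside a hyperfinite subset of `𝓜`. -/
def weilDivisors : AddSubgroup (S.InternalMaximal A b → S.HyperInt) where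
  carrier := {f | IsInternalFun f ∧ ∃ H, IsHyperfinite H ∧ ∀ p ∉ H, f p = 0}
  zero_mem' := by
    refine ⟨⟨Internal.const fun _ _ => 0, fun p c _ => ?_⟩, ∅, isHyperfinite_empty,
      fun _ _ => rfl⟩
    rw [← Internal.map_const_fun _ c]
    conv_rhs => rw [← Internal.map_id c, Internal.map_map, Internal.map₂_map_map]
    change _ = S.map _ (S.map _ _)
    rw [← S.map_comp]
    exact (map_const_fun _ _).symm
  add_mem' := by
    rintro f g ⟨⟨φ, hφ⟩, H, hH, hf⟩ ⟨⟨ψ, hψ⟩, K, hK, hg⟩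
    refine ⟨⟨Internal.map₂ (fun _ α β => α + β) φ ψ, fun p c hc => ?_⟩, H ∪ K, hH.union hK,
      fun p hp => ?_⟩
    · rw [Pi.add_apply, hφ p c hc, hψ p c hc]
      obtain ⟨t, ht, rfl⟩ := Internal.exists_pair φ ψ
      obtain ⟨w, rfl, rfl⟩ := Internal.exists_pair t c
      subst ht
      simp only [Internal.map_map, Internal.map₂_map_map]
      change S.map _ (S.map _ _) + S.map _ (S.map _ _) = S.map _ (S.map _ _)
      rw [← S.map_comp, ← S.map_comp, ← S.map_comp]
      exact map₂_map_map _ _ _ _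
    · rw [Set.mem_union, not_or] at hp
      rw [Pi.add_apply, hf p hp.1, hg p hp.2, add_zero]
  neg_mem' := by
    rintro f ⟨⟨φ, hφ⟩, H, hH, hf⟩
    refine ⟨⟨Internal.map (fun _ α => -α) φ, fun p c hc => ?_⟩, H, hH, fun p hp => ?_⟩
    · rw [Pi.neg_apply, hφ p c hc]
      obtain ⟨w, rfl, rfl⟩ := Internal.exists_pair φ c
      simp only [Internal.map_map, Internal.map₂_map_map]
      change -S.map _ (S.map _ _) = S.map _ (S.map _ _)
      rw [← S.map_comp, ← S.map_comp, obj_neg_def, ← S.map_comp]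
      rfl
    · rw [Pi.neg_apply, hf p hp, neg_zero]

/-- The lattice `𝓛` of hyperfinite subsets of `𝓜`, ordered by inclusion. -/
abbrev HyperfiniteSets : Type v := {H : Set (S.InternalMaximal A b) // IsHyperfinite H}

variable {S A b}

/-- `V(a) = {p ∈ 𝓜 | a ∈ p}`. -/
def zeroLocus (a : S.Internal A b) : Set (S.InternalMaximal A b) := {p | a ∈ p.1}

/-- `𝓕` is the ultrafilter on the lattice `𝓛` corresponding to the maximal ideal `m` of `B`:
it is a maximal proper filter, and it is the filter generated by the sets `V(a)`, for nonzero
`a ∈ m`. -/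
def IsUltrafilterOf (m : Ideal (S.Internal A b)) (𝓕 : Order.PFilter (S.HyperfiniteSets A b)) :
    Prop :=
  𝓕.dual.IsMaximal ∧
    ∀ H : S.HyperfiniteSets A b, H ∈ 𝓕 ↔ ∃ t : Finset (S.Internal A b), t.Nonempty ∧
      (∀ a ∈ t, a ∈ m ∧ a ≠ 0) ∧ ⋂ a ∈ t, zeroLocus a ⊆ H.1

/-- The internal Weil divisors that vanish on a set in `𝓕`. -/
def vanishing (𝓕 : Order.PFilter (S.HyperfiniteSets A b)) : AddSubgroup (S.weilDivisors A b) where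
  carrier := {f | ∃ H ∈ 𝓕, ∀ p ∈ H.1, f.1 p = 0}
  zero_mem' := by
    obtain ⟨H, hH⟩ := 𝓕.nonempty
    exact ⟨H, hH, fun _ _ => rfl⟩
  add_mem' := by
    rintro f g ⟨H, hH, hf⟩ ⟨K, hK, hg⟩
    obtain ⟨J, hJ, h1, h2⟩ := 𝓕.directed H hH K hK
    refine ⟨J, hJ, fun p hp => ?_⟩
    change f.1 p + g.1 p = 0
    rw [hf p (h1 hp), hg p (h2 hp), add_zero]
  neg_mem' := by
    rintro f ⟨H, hH, hf⟩
    refine ⟨H, hH, fun p hp => ?_⟩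
    change - f.1 p = 0
    rw [hf p hp, neg_zero]

/-- The group `(*⨁_𝓜 *ℤ) / 𝓕`: two internal Weil divisors are identified if they coincide on a set
in `𝓕`. -/
def DivisorsMod (𝓕 : Order.PFilter (S.HyperfiniteSets A b)) : Type v :=
  S.weilDivisors A b ⧸ vanishing 𝓕

namespace DivisorsMod

variable {𝓕 : Order.PFilter (S.HyperfiniteSets A b)}

noncomputable instance : AddCommGroup (DivisorsMod 𝓕) :=
  inferInstanceAs (AddCommGroup (S.weilDivisors A b ⧸ vanishing 𝓕))

/-- The class of an internal Weil divisor modulo `𝓕`. -/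
noncomputable def mk (f : S.weilDivisors A b) : DivisorsMod 𝓕 := QuotientAddGroup.mk f

theorem mk_eq_mk_iff (f g : S.weilDivisors A b) :
    (mk f : DivisorsMod 𝓕) = mk g ↔ ∃ H ∈ 𝓕, ∀ p ∈ H.1, f.1 p = g.1 p := by
  refine QuotientAddGroup.eq.trans ?_
  refine exists_congr fun H => and_congr_right fun _ => forall₂_congr fun p _ => ?_
  change -f.1 p + g.1 p = 0 ↔ _
  rw [neg_add_eq_zero]

/-- The order on `(*⨁_𝓜 *ℤ) / 𝓕`: pointwise comparison on a set in `𝓕`. -/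
instance : Preorder (DivisorsMod 𝓕) where
  le x y := ∃ f g : S.weilDivisors A b, mk f = x ∧ mk g = y ∧ ∃ H ∈ 𝓕, ∀ p ∈ H.1, f.1 p ≤ g.1 p
  le_refl x := by
    obtain ⟨f, rfl⟩ := QuotientAddGroup.mk_surjective x
    obtain ⟨H, hH⟩ := 𝓕.nonempty
    exact ⟨f, f, rfl, rfl, H, hH, fun _ _ => le_rfl⟩
  le_trans x y z := by
    rintro ⟨f, g, rfl, rfl, H, hH, h1⟩ ⟨g', k, hg, rfl, K, hK, h2⟩
    obtain ⟨J, hJ, h3⟩ := (mk_eq_mk_iff g' g).1 hg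
    obtain ⟨M, hM, hMH, hMK⟩ := 𝓕.directed H hH K hK
    obtain ⟨N, hN, hNM, hNJ⟩ := 𝓕.directed M hM J hJ
    refine ⟨f, k, rfl, rfl, N, hN, fun p hp => (h1 p (hMH (hNM hp))).trans ?_⟩
    rw [← h3 p (hNJ hp)]
    exact h2 p (hMK (hNM hp))

end DivisorsMod

end Divisors

end NonstandardExtension

/-- The value group of a valuation ring `R` with fraction field `L`, written additively: it is
`Lˣ / Rˣ`, with `0 ≤ v x` if and only if `x ∈ R`.  (The multiplicative `ValuationRing.ValueGroup`
includes the value of `0` and has the reverse order.) -/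
abbrev AddValueGroup (R L : Type*) [CommRing R] [IsDomain R] [ValuationRing R] [Field L]
    [Algebra R L] [IsFractionRing R L] : Type _ :=
  (Additive (ValuationRing.ValueGroup R L)ˣ)ᵒᵈ

/-!
An element of an extension determines the ultrafilter of the sets whose extension contains it, and
the transfer principle says that a relation between internal elements holds if and only if it holds
for the members of the families along this ultrafilter.  Three facts about a Dedekind domain `R`
transfer to `B`.

* Any `x` and `y` admit `s + t = 1` with `y ∣ s * x` and `x ∣ t * y`.  One of `s` and `t` is outside
  `m`, so divisibility in `B_m` is total.  Moreover, if `x` does not divide `y` in `B_m`, then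
  `s * x = y * d` with `s ∉ m` and `d ∈ m`, so the order of `x` exceeds that of `y` at almost all
  internal maximal ideals, with respect to the filter generated by the sets `V(a)`, `a ∈ m`.
* If `a ≠ 0`, any subset of the finite set `V(a)` is cut out by some `e`, in the sense that `e ∈ p`
  for `p` in the subset and `1 - e ∈ p` for the other `p ∈ V(a)`.  As `e ∈ m` or `e ∉ m`, the filter
  decides every hyperfinite set.
* If `a ≠ 0`, the Chinese remainder theorem realizes any integer-valued function on `V(a)` as the
  difference of the orders of two nonzero elements.

Hence sending `x` to its order of vanishing at the internal maximal ideals induces an isomorphism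
from the value group of `B_m` to the internal divisors modulo the filter.
-/

section OrderedGroups

theorem nonempty_orderAddIso_of_surjective {M G Γ : Type*} [AddZeroClass M] [AddZeroClass G]
    [PartialOrder G] [AddZeroClass Γ] [PartialOrder Γ] (φ : M →+ G) (ψ : M →+ Γ)
    (hφ : Function.Surjective φ) (hψ : Function.Surjective ψ)
    (h : ∀ x y, φ x ≤ φ y ↔ ψ x ≤ ψ y) : Nonempty (G ≃+o Γ) := by
  have h_eq : ∀ {x y}, φ x = φ y ↔ ψ x = ψ y := by simp only [le_antisymm_iff, h, implies_true]
  let e : G → Γ := fun g => ψ (Function.surjInv hφ g)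
  have he : ∀ x, e (φ x) = ψ x := fun x => h_eq.1 (Function.surjInv_eq hφ (φ x))
  have he_bijective : Function.Bijective e := by
    refine ⟨hφ.forall₂.2 fun x y hxy => ?_, hψ.forall.2 fun x => ⟨φ x, he x⟩⟩
    rwa [he, he, ← h_eq] at hxy
  exact ⟨{ Equiv.ofBijective e he_bijective with
    map_add' := hφ.forall₂.2 fun x y => by
      change e (φ x + φ y) = e (φ x) + e (φ y)
      rw [← map_add, he, he, he, map_add]
    map_le_map_iff' := by
      intro g g'
      obtain ⟨x, rfl⟩ := hφ g
      obtain ⟨y, rfl⟩ := hφ g'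
      change e (φ x) ≤ e (φ y) ↔ _
      rw [he, he, h] }⟩

theorem nonempty_orderAddIso_of_forall_exists_sub_eq {M G Γ : Type*} [AddZeroClass M]
    [AddCommGroup G] [PartialOrder G] [IsOrderedAddMonoid G]
    [AddCommGroup Γ] [PartialOrder Γ] [IsOrderedAddMonoid Γ] (φ : M →+ G) (ψ : M →+ Γ)
    (hφ : ∀ g, ∃ x y, φ x - φ y = g) (hψ : ∀ γ, ∃ x y, ψ x - ψ y = γ)
    (h : ∀ x y, φ x ≤ φ y ↔ ψ x ≤ ψ y) : Nonempty (G ≃+o Γ) := by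
  refine nonempty_orderAddIso_of_surjective (φ.coprod (-φ)) (ψ.coprod (-ψ))
    (fun g => ?_) (fun γ => ?_) fun p q => ?_
  · obtain ⟨x, y, rfl⟩ := hφ g
    exact ⟨(x, y), (sub_eq_add_neg _ _).symm⟩
  · obtain ⟨x, y, rfl⟩ := hψ γ
    exact ⟨(x, y), (sub_eq_add_neg _ _).symm⟩
  · simp only [AddMonoidHom.coprod_apply, AddMonoidHom.neg_apply, ← sub_eq_add_neg,
      sub_le_sub_iff, ← map_add, h]

instance {X : Type*} [AddCommMonoid X] [Preorder X] [IsOrderedAddMonoid X] :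
    IsOrderedAddMonoid (ULift X) where
  add_le_add_left _ _ h _ := add_le_add_left (α := X) h _

end OrderedGroups

section Localization

theorem algebraMap_dvd_algebraMap_iff_of_isLocalization {B R : Type*} [CommRing B] [CommRing R]
    [Algebra B R] (M : Submonoid B) [IsLocalization M R] {x y : B} :
    algebraMap B R x ∣ algebraMap B R y ↔ ∃ t ∈ M, x ∣ t * y := by
  constructor
  · rintro ⟨c, hc⟩
    obtain ⟨⟨d, s⟩, hds⟩ := IsLocalization.surj M c
    have h : algebraMap B R (s * y) = algebraMap B R (x * d) := by
      rw [map_mul, map_mul, hc, ← hds]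
      ring
    obtain ⟨t, ht⟩ := (IsLocalization.eq_iff_exists M R).1 h
    refine ⟨t * s, mul_mem t.2 s.2, t * d, ?_⟩
    linear_combination ht
  · rintro ⟨t, ht, hxy⟩
    have h := map_dvd (algebraMap B R) hxy
    rw [map_mul] at h
    exact (IsLocalization.map_units R ⟨t, ht⟩).dvd_mul_left.1 h

theorem valuationRing_of_exists_add_eq_one_dvd_mul {B R : Type*} [CommRing B] [CommRing R]
    [IsDomain R] [Algebra B R] (m : Ideal B) [m.IsPrime] [IsLocalization.AtPrime R m]
    (h : ∀ x y : B, ∃ s t, s + t = 1 ∧ y ∣ s * x ∧ x ∣ t * y) : ValuationRing R := by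
  have h_total (x y : B) : algebraMap B R x ∣ algebraMap B R y ∨
      algebraMap B R y ∣ algebraMap B R x := by
    simp only [algebraMap_dvd_algebraMap_iff_of_isLocalization m.primeCompl]
    obtain ⟨s, t, hst, hs, ht⟩ := h x y
    by_cases htm : t ∈ m
    · refine Or.inr ⟨s, fun hsm => m.one_notMem ?_, hs⟩
      exact hst ▸ m.add_mem hsm htm
    · exact Or.inl ⟨t, htm, ht⟩
  have h_associated (r : R) : ∃ x : B, Associated r (algebraMap B R x) := by
    obtain ⟨⟨x, s⟩, hx⟩ := IsLocalization.surj m.primeCompl r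
    exact ⟨x, (IsLocalization.map_units R s).unit, hx⟩
  refine ValuationRing.iff_dvd_total.2 ⟨fun r r' => ?_⟩
  obtain ⟨x, hx⟩ := h_associated r
  obtain ⟨y, hy⟩ := h_associated r'
  rw [hx.dvd_iff_dvd_left, hy.dvd_iff_dvd_right, hx.dvd_iff_dvd_right, hy.dvd_iff_dvd_left]
  exact h_total x y

theorem exists_algebraMap_algebraMap_div_eq {B R L : Type*} [CommRing B] [CommRing R] [Field L]
    [Algebra B R] [Algebra R L] [IsFractionRing R L] (M : Submonoid B) [IsLocalization M R]
    (x : L) :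
    ∃ a d : B, algebraMap R L (algebraMap B R a) / algebraMap R L (algebraMap B R d) = x := by
  obtain ⟨r, s, -, rfl⟩ := IsFractionRing.div_surjective R x
  obtain ⟨⟨a, t⟩, ha⟩ := IsLocalization.surj M r
  obtain ⟨⟨d, u⟩, hd⟩ := IsLocalization.surj M s
  have h_unit (v : M) : algebraMap R L (algebraMap B R v) ≠ 0 :=
    ((IsLocalization.map_units R v).map (algebraMap R L)).ne_zero
  refine ⟨a * u, d * t, ?_⟩
  rw [map_mul, map_mul, map_mul, map_mul, ← ha, ← hd, map_mul, map_mul, mul_right_comm,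
    mul_div_mul_right _ _ (h_unit t), mul_div_mul_right _ _ (h_unit u)]

end Localization

section ValueGroup

open scoped nonZeroDivisors

variable (R L : Type*) [CommRing R] [IsDomain R] [ValuationRing R] [Field L] [Algebra R L]
  [IsFractionRing R L]

/-- The valuation of a valuation ring on the units of its fraction field, with values in the
additive value group. -/
noncomputable def addValuation : Additive Lˣ →+ AddValueGroup R L where
  toFun x := .toDual (.ofMul (Units.map (ValuationRing.valuation R L).toMonoidHom x.toMul))
  map_zero' := congrArg (fun γ => OrderDual.toDual (Additive.ofMul γ)) (map_one (Units.map _))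
  map_add' _ _ := congrArg (fun γ => OrderDual.toDual (Additive.ofMul γ))
    (map_mul (Units.map _) _ _)

theorem addValuation_surjective : Function.Surjective (addValuation R L) := by
  intro g
  let γ : (ValuationRing.ValueGroup R L)ˣ := (OrderDual.ofDual g).toMul
  obtain ⟨x, hx⟩ := Quotient.mk''_surjective (γ : ValuationRing.ValueGroup R L)
  change ValuationRing.valuation R L x = γ at hx
  have hx0 : x ≠ 0 := (Valuation.ne_zero_iff _).1 (hx ▸ γ.ne_zero)
  exact ⟨.ofMul (Units.mk0 x hx0), congrArg (fun γ => OrderDual.toDual (Additive.ofMul γ))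
    (Units.ext hx)⟩

variable {R L}

theorem addValuation_le_iff_dvd {x y : Lˣ} {r s : R} (hr : algebraMap R L r = x)
    (hs : algebraMap R L s = y) :
    addValuation R L (.ofMul x) ≤ addValuation R L (.ofMul y) ↔ r ∣ s := by
  change (∃ c : R, c • (x : L) = y) ↔ _
  rw [← hr, ← hs]
  refine exists_congr fun c => ?_
  rw [Algebra.smul_def, ← map_mul, (IsFractionRing.injective R L).eq_iff, mul_comm, eq_comm]

theorem nonempty_addValueGroup_orderAddIso {B Γ : Type*} [CommRing B] [IsDomain B] [Algebra B R]
    (M : Submonoid B) (hM : M ≤ B⁰) [IsLocalization M R]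
    [AddCommGroup Γ] [PartialOrder Γ] [IsOrderedAddMonoid Γ] (ν : Additive B⁰ →+ Γ)
    (hν : ∀ x y : B⁰, ν (.ofMul x) ≤ ν (.ofMul y) ↔ ∃ t ∈ M, (x : B) ∣ t * y)
    (hν_sub : ∀ γ, ∃ x y, ν x - ν y = γ) : Nonempty (AddValueGroup R L ≃+o Γ) := by
  let f : B →+* L := (algebraMap R L).comp (algebraMap B R)
  have hf_injective : Function.Injective f :=
    (IsFractionRing.injective R L).comp (IsLocalization.injective R hM)
  have hf (x : B⁰) : IsUnit (f x) :=
    ((map_ne_zero_iff f hf_injective).2 (nonZeroDivisors.ne_zero x.2)).isUnit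
  let toUnits : B⁰ →* Lˣ := IsUnit.liftRight ((f : B →* L).comp B⁰.subtype) hf
  refine nonempty_orderAddIso_of_forall_exists_sub_eq
    ((addValuation R L).comp toUnits.toAdditive) ν ?_ hν_sub ?_
  · intro g
    obtain ⟨x, rfl⟩ := addValuation_surjective R L g
    obtain ⟨a, d, hx⟩ := exists_algebraMap_algebraMap_div_eq (R := R) M (x.toMul : L)
    have hx0 : f a / f d ≠ 0 := hx ▸ x.toMul.ne_zero
    have ha : a ∈ B⁰ := mem_nonZeroDivisors_of_ne_zero
      ((map_ne_zero_iff f hf_injective).1 (div_ne_zero_iff.1 hx0).1)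
    have hd : d ∈ B⁰ := mem_nonZeroDivisors_of_ne_zero
      ((map_ne_zero_iff f hf_injective).1 (div_ne_zero_iff.1 hx0).2)
    refine ⟨.ofMul ⟨a, ha⟩, .ofMul ⟨d, hd⟩, ?_⟩
    have h : toUnits ⟨a, ha⟩ / toUnits ⟨d, hd⟩ = x.toMul := by
      ext
      rw [Units.val_div_eq_div_val]
      exact hx
    exact (map_sub (addValuation R L) _ _).symm.trans (congrArg _ h)
  · intro x y
    exact (addValuation_le_iff_dvd rfl rfl).trans
      ((algebraMap_dvd_algebraMap_iff_of_isLocalization M).trans (hν x.toMul y.toMul).symm)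

end ValueGroup

section Dedekind

theorem one_sub_notMem_of_mem {R : Type*} [Ring R] {P : Ideal R} (hP : P ≠ ⊤) {e : R} (he : e ∈ P) :
    1 - e ∉ P := fun h =>
  P.ne_top_iff_one.1 hP (sub_add_cancel 1 e ▸ P.add_mem h he)

theorem exists_forall_mem_and_one_sub_mem {R : Type*} [CommRing R] {F : Set (Ideal R)}
    (hF : F.Finite) (hF_max : ∀ P ∈ F, P.IsMaximal) (H : Set (Ideal R)) :
    ∃ e : R, ∀ P ∈ F, (P ∈ H → e ∈ P) ∧ (P ∉ H → 1 - e ∈ P) := by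
  classical
  have := hF.to_subtype
  have h_coprime : Pairwise (Function.onFun IsCoprime fun P : F => P.1) := fun P Q hPQ =>
    haveI := hF_max P P.2
    haveI := hF_max Q Q.2
    Ideal.isCoprime_of_isMaximal (Subtype.coe_injective.ne hPQ)
  obtain ⟨e, he⟩ := Ideal.exists_forall_sub_mem_ideal h_coprime
    fun P => if P.1 ∈ H then 0 else 1
  refine ⟨e, fun P hP => ⟨fun hPH => ?_, fun hPH => ?_⟩⟩
  · simpa [hPH] using he ⟨P, hP⟩
  · simpa [hPH] using neg_mem (he ⟨P, hP⟩)

variable {R : Type*} [CommRing R] [IsDedekindDomain R]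

theorem finite_setOf_isMaximal_mem {a : R} (ha : a ≠ 0) :
    {P : Ideal R | P.IsMaximal ∧ a ∈ P}.Finite := by
  have h : Ideal.span {a} ≠ 0 := by simpa using ha
  refine ((Ideal.finite_factors h).image fun v => v.asIdeal).subset ?_
  rintro P ⟨hP, haP⟩
  have hP0 : P ≠ ⊥ := by
    rintro rfl
    exact ha haP
  exact ⟨⟨P, hP.isPrime, hP0⟩, Ideal.dvd_span_singleton.2 haP, rfl⟩

theorem exists_add_eq_one_dvd_mul (x y : R) : ∃ s t, s + t = 1 ∧ y ∣ s * x ∧ x ∣ t * y := by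
  by_cases h0 : Ideal.span {x} ⊔ Ideal.span {y} = 0
  · obtain ⟨hx, hy⟩ : x = 0 ∧ y = 0 := by simpa [Ideal.zero_eq_bot] using h0
    exact ⟨1, 0, add_zero 1, by simp [hx], by simp [hy]⟩
  obtain ⟨K, hK⟩ := Ideal.dvd_iff_le.2
    (le_sup_left : Ideal.span {x} ≤ Ideal.span {x} ⊔ Ideal.span {y})
  obtain ⟨J, hJ⟩ := Ideal.dvd_iff_le.2
    (le_sup_right : Ideal.span {y} ≤ Ideal.span {x} ⊔ Ideal.span {y})
  have h_coprime : J ⊔ K = ⊤ := by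
    rw [sup_comm, ← Ideal.one_eq_top]
    refine mul_left_cancel₀ h0 ?_
    rw [Ideal.mul_sup, ← hK, ← hJ, mul_one]
  obtain ⟨s, hs, t, ht, hst⟩ := Submodule.mem_sup.1 ((Ideal.eq_top_iff_one _).1 h_coprime)
  refine ⟨s, t, hst, ?_, ?_⟩
  · have h := Ideal.mul_mem_mul hs (Ideal.mem_span_singleton_self x)
    rw [hK, mul_left_comm, ← mul_assoc, ← hJ] at h
    exact Ideal.mem_span_singleton.1 (Ideal.mul_le_left h)
  · have h := Ideal.mul_mem_mul ht (Ideal.mem_span_singleton_self y)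
    rw [hJ, mul_left_comm, ← mul_assoc, ← hK] at h
    exact Ideal.mem_span_singleton.1 (Ideal.mul_le_left h)

theorem multiplicity_span_singleton_mul {P : Ideal R} (hP : Prime P) {a c : R} (ha : a ≠ 0)
    (hc : c ≠ 0) : multiplicity P (Ideal.span {a * c}) =
      multiplicity P (Ideal.span {a}) + multiplicity P (Ideal.span {c}) := by
  have h : FiniteMultiplicity P (Ideal.span {a} * Ideal.span {c}) :=
    FiniteMultiplicity.of_prime_left hP (by simpa using ⟨ha, hc⟩)
  rw [← Ideal.span_singleton_mul_span_singleton, multiplicity_mul hP h]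

theorem multiplicity_span_singleton_eq_iff {P : Ideal R} (hP : Prime P) {a : R} (ha : a ≠ 0)
    {n : ℕ} : multiplicity P (Ideal.span {a}) = n ↔ a ∈ P ^ n ∧ a ∉ P ^ (n + 1) := by
  have h : FiniteMultiplicity P (Ideal.span {a}) :=
    FiniteMultiplicity.of_prime_left hP (by simpa using ha)
  simp only [h.multiplicity_eq_iff, Ideal.dvd_span_singleton]

theorem exists_ne_zero_multiplicity_span_singleton_eq {F : Set (Ideal R)} (hF : F.Finite)
    (hF_prime : ∀ P ∈ F, Prime P) (n : Ideal R → ℕ) :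
    ∃ a : R, a ≠ 0 ∧ ∀ P ∈ F, multiplicity P (Ideal.span {a}) = n P := by
  lift F to Finset (Ideal R) using hF
  have h_local (P : F) : ∃ x ∈ P.1 ^ n P, x ∉ P.1 ^ (n P + 1) :=
    Ideal.exists_mem_pow_notMem_pow_succ P.1 (hF_prime P P.2).ne_zero
      (Ideal.isPrime_of_prime (hF_prime P P.2)).ne_top _
  choose x hx_mem hx_notMem using h_local
  obtain ⟨a, ha⟩ := IsDedekindDomain.exists_forall_sub_mem_ideal (s := F) id (fun P => n P + 1)
    hF_prime (fun _ _ _ _ => id) x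
  have ha_mem (P : F) : a ∈ P.1 ^ n P :=
    (Submodule.sub_mem_iff_left _ (hx_mem P)).1 (Ideal.pow_le_pow_right (Nat.le_succ _) (ha P P.2))
  have ha_notMem (P : F) : a ∉ P.1 ^ (n P + 1) := fun h =>
    hx_notMem P ((Submodule.sub_mem_iff_right _ h).1 (ha P P.2))
  rcases F.eq_empty_or_nonempty with rfl | ⟨Q, hQ⟩
  · exact ⟨1, one_ne_zero, by simp⟩
  have ha0 : a ≠ 0 := by
    rintro rfl
    exact ha_notMem ⟨Q, hQ⟩ (Ideal.zero_mem _)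
  exact ⟨a, ha0, fun P hP => (multiplicity_span_singleton_eq_iff (hF_prime P hP) ha0).2
    ⟨ha_mem ⟨P, hP⟩, ha_notMem ⟨P, hP⟩⟩⟩

end Dedekind

section MaximalSets

variable {R : Type*} [CommRing R]

/-- The subset `s` of `R` is (the carrier of) a maximal ideal.  Internal ideals are coded by
internal families of subsets, so transfer needs maximality as a property of sets. -/
def IsMaximalSet (s : Set R) : Prop := ∃ P : Ideal R, P.IsMaximal ∧ (P : Set R) = s

theorem isMaximalSet_iff {s : Set R} : IsMaximalSet s ↔
    0 ∈ s ∧ (∀ x y z, x ∈ s → y ∈ s → x + z * y ∈ s) ∧ 1 ∉ s ∧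
      ∀ x, x ∉ s → ∃ y, 1 - x * y ∈ s := by
  constructor
  · rintro ⟨P, hP, rfl⟩
    refine ⟨P.zero_mem, fun x y z hx hy => P.add_mem hx (P.mul_mem_left z hy),
      P.ne_top_iff_one.1 hP.ne_top, fun x hx => ?_⟩
    obtain ⟨y, i, hi, h⟩ := hP.exists_inv hx
    exact ⟨y, by rwa [← h, mul_comm x, add_sub_cancel_left]⟩
  · rintro ⟨h_zero, h_add_mul, h_one, h_inv⟩
    let P : Ideal R :=
      { carrier := s
        zero_mem' := h_zero
        add_mem' := fun {x y} hx hy => by simpa only [one_mul] using h_add_mul x y 1 hx hy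
        smul_mem' := fun z y hy => by
          simpa only [zero_add, smul_eq_mul] using h_add_mul 0 y z h_zero hy }
    refine ⟨P, ⟨P.ne_top_iff_one.2 h_one, fun J hJ => ?_⟩, rfl⟩
    obtain ⟨x, hxJ, hxP⟩ := SetLike.exists_of_lt hJ
    obtain ⟨y, hy⟩ := h_inv x hxP
    rw [Ideal.eq_top_iff_one, ← sub_add_cancel 1 (x * y)]
    exact J.add_mem (hJ.le hy) (J.mul_mem_right y hxJ)

/-- The order of vanishing of `a` at the ideal with carrier `s`: the multiplicity of this ideal in
`(a)`. -/
noncomputable def idealOrder (s : Set R) (a : R) : ℕ :=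
  multiplicity (Ideal.span s) (Ideal.span {a})

theorem idealOrder_coe (P : Ideal R) (a : R) :
    idealOrder (P : Set R) a = multiplicity P (Ideal.span {a}) := by
  rw [idealOrder, Ideal.span_eq]

variable [IsDedekindDomain R]

theorem prime_of_isMaximal_of_not_isField (hR : ¬ IsField R) {P : Ideal R}
    (hP : P.IsMaximal) : Prime P :=
  Ideal.prime_of_isPrime (Ring.ne_bot_of_isMaximal_of_not_isField hP hR) hP.isPrime

theorem idealOrder_eq_zero_iff {s : Set R} (hs : IsMaximalSet s) {a : R} :
    idealOrder s a = 0 ↔ a ∉ s := by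
  obtain ⟨P, -, rfl⟩ := hs
  rw [idealOrder_coe, multiplicity_eq_zero, Ideal.dvd_span_singleton, SetLike.mem_coe]

theorem idealOrder_mul (hR : ¬ IsField R) {s : Set R} (hs : IsMaximalSet s) {a c : R}
    (ha : a ≠ 0) (hc : c ≠ 0) :
    idealOrder s (a * c) = idealOrder s a + idealOrder s c := by
  obtain ⟨P, hP, rfl⟩ := hs
  simp only [idealOrder_coe]
  exact multiplicity_span_singleton_mul (prime_of_isMaximal_of_not_isField hR hP) ha hc

theorem finite_setOf_isMaximalSet_mem {a : R} (ha : a ≠ 0) :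
    {s | IsMaximalSet s ∧ a ∈ s}.Finite := by
  refine ((finite_setOf_isMaximal_mem ha).image ((↑) : Ideal R → Set R)).subset ?_
  rintro _ ⟨⟨P, hP, rfl⟩, haP⟩
  exact ⟨P, ⟨hP, haP⟩, rfl⟩

theorem exists_forall_isMaximalSet_mem_and_one_sub_mem {a : R} (ha : a ≠ 0)
    (H : Set (Set R)) : ∃ e, ∀ s, IsMaximalSet s → a ∈ s →
      (s ∈ H → e ∈ s) ∧ (s ∉ H → 1 - e ∈ s) := by
  obtain ⟨e, he⟩ := exists_forall_mem_and_one_sub_mem (finite_setOf_isMaximal_mem ha)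
    (fun _ hP => hP.1) {P | (P : Set R) ∈ H}
  refine ⟨e, ?_⟩
  rintro _ ⟨P, hP, rfl⟩ haP
  exact he P ⟨hP, haP⟩

theorem exists_forall_isMaximalSet_idealOrder_eq_add (hR : ¬ IsField R) {a : R}
    (ha : a ≠ 0) (n : Set R → ℤ) : ∃ x y, x ≠ 0 ∧ y ≠ 0 ∧ ∀ s, IsMaximalSet s → a ∈ s →
      (idealOrder s x : ℤ) = n s + idealOrder s y := by
  have h_finite := finite_setOf_isMaximal_mem ha
  have h_prime : ∀ P ∈ {P : Ideal R | P.IsMaximal ∧ a ∈ P}, Prime P := fun _ hP =>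
    prime_of_isMaximal_of_not_isField hR hP.1
  obtain ⟨x, hx, hx_order⟩ :=
    exists_ne_zero_multiplicity_span_singleton_eq h_finite h_prime fun P => (n P).toNat
  obtain ⟨y, hy, hy_order⟩ :=
    exists_ne_zero_multiplicity_span_singleton_eq h_finite h_prime fun P => (-n P).toNat
  refine ⟨x, y, hx, hy, ?_⟩
  rintro _ ⟨P, hP, rfl⟩ haP
  rw [idealOrder_coe, idealOrder_coe, hx_order P ⟨hP, haP⟩, hy_order P ⟨hP, haP⟩]
  omega

end MaximalSets

namespace NonstandardExtension

variable {S : NonstandardExtension.{u, v}}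

/-- The ultrafilter of all sets whose extension contains `x`.  Transfer at `x` is reasoning with
`∀ᶠ` along this ultrafilter. -/
def ultrafilter {X : Type u} (x : S.obj X) : Ultrafilter X :=
  Ultrafilter.ofComplNotMemIff
    { sets := {s | x ∈ S.ext s}
      univ_sets := by rw [Set.mem_ofPred_eq, ext_univ]; trivial
      sets_of_superset := fun hs hst => ext_mono hst hs
      inter_sets := fun {s t} hs ht => by rw [Set.mem_ofPred_eq, ext_inter]; exact ⟨hs, ht⟩ }
    fun s => by
      change x ∉ S.ext sᶜ ↔ x ∈ S.ext s
      rw [ext_compl, Set.notMem_compl_iff]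

theorem eventually_ultrafilter_map_iff {X Y : Type u} {f : X → Y} {x : S.obj X} {P : Y → Prop} :
    (∀ᶠ a in ultrafilter (S.map f x), P a) ↔ ∀ᶠ a in ultrafilter x, P (f a) := by
  change _ ↔ x ∈ S.ext (f ⁻¹' {a | P a})
  rw [ext_preimage]
  rfl

theorem map_eq_map_iff_eventually {X Y : Type u} {f g : X → Y} {x : S.obj X} :
    S.map f x = S.map g x ↔ ∀ᶠ a in ultrafilter x, f a = g a :=
  S.map_eq_map_iff f g x

theorem map_le_map_iff_eventually {X Y : Type u} [Preorder Y] {f g : X → Y} {x : S.obj X} :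
    S.map f x ≤ S.map g x ↔ ∀ᶠ a in ultrafilter x, f a ≤ g a := by
  change S.pair.symm (S.map f x, S.map g x) ∈ S.ext {p : Y × Y | p.1 ≤ p.2} ↔ _
  rw [pair_symm_map]
  exact eventually_ultrafilter_map_iff (P := fun p : Y × Y => p.1 ≤ p.2)

theorem map_add_map {X Y : Type u} [AddCommGroup Y] (f g : X → Y) (x : S.obj X) :
    S.map f x + S.map g x = S.map (fun a => f a + g a) x :=
  map₂_map_map _ f g x

instance {X : Type u} [PartialOrder X] : PartialOrder (S.obj X) where
  le_antisymm x y hxy hyx := by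
    obtain ⟨w, rfl, rfl⟩ := exists_pair (S := S) x y
    rw [map_le_map_iff_eventually] at hxy hyx
    exact map_eq_map_iff_eventually.2 (hxy.mp (hyx.mono fun _ => ge_antisymm))

instance {X : Type u} [AddCommGroup X] [Preorder X] [IsOrderedAddMonoid X] :
    IsOrderedAddMonoid (S.obj X) where
  add_le_add_left x y h z := by
    obtain ⟨t, ht, rfl⟩ := exists_pair (S := S) x y
    obtain ⟨w, rfl, rfl⟩ := exists_pair (S := S) t z
    subst ht
    simp only [← S.map_comp, map_le_map_iff_eventually, map_add_map] at h ⊢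
    exact h.mono fun _ ha => add_le_add_left ha _

namespace Internal

variable {I : Type u} {b : S.obj I} {X : Type u} {Y Z T : I → Type u}

/-- The ultrafilter of transfer at the internal element `w`.  Its points are pairs of an index and
an element of the member at this index of the family to which `w` belongs. -/
def ultra (w : Internal S T b) : Filter (Σ i, T i) := ultrafilter w.1

theorem eventually_not {w : Internal S T b} {P : (Σ i, T i) → Prop} :
    (∀ᶠ q in w.ultra, ¬ P q) ↔ ¬ ∀ᶠ q in w.ultra, P q :=
  Ultrafilter.eventually_not (f := ultrafilter w.1)

theorem eventually_imp {w : Internal S T b} {P Q : (Σ i, T i) → Prop} :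
    (∀ᶠ q in w.ultra, P q → Q q) ↔ ((∀ᶠ q in w.ultra, P q) → ∀ᶠ q in w.ultra, Q q) :=
  Ultrafilter.eventually_imp (f := ultrafilter w.1)

theorem eventually_ultra_map_iff {f : ∀ i, T i → Y i} {w : Internal S T b}
    {P : (Σ i, Y i) → Prop} :
    (∀ᶠ q in (map f w).ultra, P q) ↔ ∀ᶠ q in w.ultra, P ⟨q.1, f q.1 q.2⟩ :=
  NonstandardExtension.eventually_ultrafilter_map_iff

theorem eventually_of_mem_ext {P : I → Prop} (h : b ∈ S.ext {i | P i}) (w : Internal S T b) :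
    ∀ᶠ q in w.ultra, P q.1 := by
  rw [← w.2] at h
  exact NonstandardExtension.eventually_ultrafilter_map_iff.1 h

theorem map_eq_map_iff {f g : ∀ i, T i → Y i} {w : Internal S T b} :
    map f w = map g w ↔ ∀ᶠ q in w.ultra, f q.1 q.2 = g q.1 q.2 := by
  refine Subtype.ext_iff.trans (map_eq_map_iff_eventually.trans ?_)
  simp only [Sigma.mk.injEq, heq_eq_eq, true_and, ultra]

theorem rel_map_map_iff {R : ∀ i, Y i → Z i → Prop} {g : ∀ i, T i → Y i} {h : ∀ i, T i → Z i}
    {w : Internal S T b} :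
    Rel R (map g w) (map h w) ↔ ∀ᶠ q in w.ultra, R q.1 (g q.1 q.2) (h q.1 q.2) := by
  rw [rel_map_map]
  rfl

theorem exists_eventually_of_eventually_exists [∀ i, Nonempty (Y i)] {w : Internal S T b}
    {R : ∀ i, T i → Y i → Prop} (h : ∀ᶠ q in w.ultra, ∃ y, R q.1 q.2 y) :
    ∃ g : ∀ i, T i → Y i, ∀ᶠ q in w.ultra, R q.1 q.2 (g q.1 q.2) :=
  ⟨fun i t => Classical.epsilon (R i t), h.mono fun _ => Classical.epsilon_spec⟩

theorem eventually_forall_iff [∀ i, Nonempty (Y i)] {w : Internal S T b}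
    {R : ∀ i, T i → Y i → Prop} : (∀ᶠ q in w.ultra, ∀ y, R q.1 q.2 y) ↔
      ∀ u : Internal S (fun i => T i × Y i) b, map (fun _ p => p.1) u = w →
        ∀ᶠ q in u.ultra, R q.1 q.2.1 q.2.2 := by
  constructor
  · rintro h u rfl
    exact (eventually_ultra_map_iff.1 h).mono fun q hq => hq _
  · contrapose
    rw [← Internal.eventually_not]
    simp only [not_forall]
    intro h
    obtain ⟨g, hg⟩ := exists_eventually_of_eventually_exists (R := fun i t y => ¬ R i t y) h
    refine ⟨map (fun i t => (t, g i t)) w, by rw [map_map, map_id], ?_⟩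
    rw [eventually_ultra_map_iff, ← Internal.eventually_not]
    exact hg

section Ring

variable {A : I → Type u} [∀ i, CommRing (A i)] {f g : ∀ i, T i → A i} {w : Internal S T b}

theorem map_add_map : map f w + map g w = map (fun i a => f i a + g i a) w :=
  map₂_map_map _ f g w

theorem map_mul_map : map f w * map g w = map (fun i a => f i a * g i a) w :=
  map₂_map_map _ f g w

theorem map_sub_map : map f w - map g w = map (fun i a => f i a - g i a) w := by
  rw [sub_eq_iff_eq_add, map_add_map]
  simp only [sub_add_cancel]

variable (A) in
theorem zero_eq_map (w : Internal S T b) : (0 : Internal S A b) = map (fun _ _ => 0) w :=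
  (map_const_fun _ w).symm

variable (A) in
theorem one_eq_map (w : Internal S T b) : (1 : Internal S A b) = map (fun _ _ => 1) w :=
  (map_const_fun _ w).symm

theorem map_ne_zero_iff : map f w ≠ 0 ↔ ∀ᶠ q in w.ultra, f q.1 q.2 ≠ 0 := by
  rw [Ne, zero_eq_map A w, map_eq_map_iff, Internal.eventually_not]

theorem map_eq_one_iff : map f w = 1 ↔ ∀ᶠ q in w.ultra, f q.1 q.2 = 1 := by
  rw [one_eq_map A w, map_eq_map_iff]

theorem map_dvd_map_iff : map f w ∣ map g w ↔ ∀ᶠ q in w.ultra, f q.1 q.2 ∣ g q.1 q.2 := by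
  constructor
  · rintro ⟨c, hc⟩
    obtain ⟨u, rfl, rfl⟩ := exists_pair w c
    rw [map_map, map_map, map_mul_map, map_eq_map_iff] at hc
    exact eventually_ultra_map_iff.2 (hc.mono fun _ => Dvd.intro _ ∘ Eq.symm)
  · intro h
    obtain ⟨c, hc⟩ := exists_eventually_of_eventually_exists (R := fun i t c => g i t = f i t * c) h
    exact ⟨map c w, by rwa [map_mul_map, map_eq_map_iff]⟩

theorem isUnit_map_iff : IsUnit (map f w) ↔ ∀ᶠ q in w.ultra, IsUnit (f q.1 q.2) := by
  simp only [isUnit_iff_dvd_one]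
  rw [one_eq_map A w, map_dvd_map_iff]

theorem isCoprime_map_map (h : ∀ᶠ q in w.ultra, IsCoprime (f q.1 q.2) (g q.1 q.2)) :
    IsCoprime (map f w) (map g w) := by
  obtain ⟨c, hc⟩ := exists_eventually_of_eventually_exists (Y := fun i => A i × A i)
    (R := fun i t c => c.1 * f i t + c.2 * g i t = 1)
    (by simpa only [Prod.exists, IsCoprime] using h)
  refine ⟨map (fun i t => (c i t).1) w, map (fun i t => (c i t).2) w, ?_⟩
  rwa [map_mul_map, map_mul_map, map_add_map, map_eq_one_iff]

end Ring

section toStar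

variable {f g : ∀ i, T i → X} {w : Internal S T b}

theorem toStar_map : toStar (map f w) = S.map (fun q => f q.1 q.2) w.1 :=
  (S.map_comp _ _ _).symm

theorem toStar_map_eq_iff :
    toStar (map f w) = toStar (map g w) ↔ ∀ᶠ q in w.ultra, f q.1 q.2 = g q.1 q.2 := by
  rw [toStar_map, toStar_map, map_eq_map_iff_eventually, ultra]

theorem toStar_map_add_toStar_map [AddCommGroup X] :
    toStar (map f w) + toStar (map g w) = toStar (map (fun i t => f i t + g i t) w) := by
  simp only [toStar_map, NonstandardExtension.map_add_map]

theorem zero_eq_toStar_map [AddCommGroup X] (w : Internal S T b) :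
    (0 : S.obj X) = toStar (map (fun _ _ => 0) w) := by
  rw [toStar_map, obj_zero_def, NonstandardExtension.map_const_fun]

theorem zero_le_toStar_map_iff [AddCommGroup X] [Preorder X] :
    0 ≤ toStar (map f w) ↔ ∀ᶠ q in w.ultra, 0 ≤ f q.1 q.2 := by
  rw [zero_eq_toStar_map w, toStar_map, toStar_map, map_le_map_iff_eventually, ultra]

theorem toStar_map_eq_zero_iff [AddCommGroup X] :
    toStar (map f w) = 0 ↔ ∀ᶠ q in w.ultra, f q.1 q.2 = 0 := by
  rw [zero_eq_toStar_map w, toStar_map_eq_iff]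

end toStar

theorem toStar_surjective :
    Function.Surjective (toStar : Internal S (fun _ : I => X) b → S.obj X) := by
  intro z
  obtain ⟨w, rfl, rfl⟩ := NonstandardExtension.exists_pair b z
  refine ⟨⟨S.map (fun p => ⟨p.1, p.2⟩) w, ?_⟩, ?_⟩
  · rw [← S.map_comp]
    rfl
  · change S.map _ (S.map _ _) = _
    rw [← S.map_comp]
    rfl

end Internal

section Codes

open Internal

variable {I : Type u} {A : I → Type u} {b : S.obj I} {T : I → Type u}
  {c d : S.Internal (fun i => Set (A i)) b} {U : Set (S.Internal A b)}

theorem codes_setOf (c : S.Internal (fun i => Set (A i)) b) :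
    Codes c {x | Internal.Rel (fun _ x s => x ∈ s) x c} := fun _ => Iff.rfl

theorem Codes.map_mem_iff (hU : Codes c U) {w : S.Internal T b} {s : ∀ i, T i → Set (A i)}
    (hs : Internal.map s w = c) {f : ∀ i, T i → A i} :
    Internal.map f w ∈ U ↔ ∀ᶠ q in w.ultra, f q.1 q.2 ∈ s q.1 q.2 := by
  rw [hU, ← hs, rel_map_map_iff]

theorem Codes.eq [∀ i, Nonempty (A i)] (hc : Codes c U) (hd : Codes d U) : c = d := by
  obtain ⟨w, rfl, rfl⟩ := Internal.exists_pair c d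
  rw [Internal.map_eq_map_iff]
  simp only [Set.ext_iff]
  rw [eventually_forall_iff (Y := A)
    (R := fun i (p : Set (A i) × Set (A i)) x => x ∈ p.1 ↔ x ∈ p.2)]
  rintro u rfl
  rw [Internal.map_map] at hc hd
  have h_iff := (hc.map_mem_iff rfl (f := fun _ p => p.2)).symm.trans (hd.map_mem_iff rfl)
  simp only [iff_iff_implies_and_implies, Filter.eventually_and, Internal.eventually_imp] at h_iff ⊢
  exact h_iff

variable [∀ i, CommRing (A i)]

theorem Codes.zero_mem_iff (hc : Codes c U) : 0 ∈ U ↔ ∀ᶠ q in c.ultra, 0 ∈ q.2 := by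
  rw [zero_eq_map A c, hc.map_mem_iff (Internal.map_id c)]

theorem Codes.one_notMem_iff (hc : Codes c U) : 1 ∉ U ↔ ∀ᶠ q in c.ultra, 1 ∉ q.2 := by
  rw [one_eq_map A c, hc.map_mem_iff (Internal.map_id c), Internal.eventually_not]

theorem Codes.forall_add_mul_mem_iff (hc : Codes c U) :
    (∀ x y z, x ∈ U → y ∈ U → x + z * y ∈ U) ↔
      ∀ᶠ q in c.ultra, ∀ x y z : A q.1, x ∈ q.2 → y ∈ q.2 → x + z * y ∈ q.2 := by
  have h_triple := eventually_forall_iff (w := c) (Y := fun i => A i × A i × A i)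
    (R := fun _ s t => t.1 ∈ s → t.2.1 ∈ s → t.1 + t.2.2 * t.2.1 ∈ s)
  simp only [Prod.forall, Internal.eventually_imp] at h_triple
  rw [h_triple]
  constructor
  · intro h u hu
    have h_u := h (Internal.map (fun _ p => p.2.1) u) (Internal.map (fun _ p => p.2.2.1) u)
      (Internal.map (fun _ p => p.2.2.2) u)
    simpa only [map_mul_map, Internal.map_add_map, hc.map_mem_iff hu] using h_u
  · intro h x y z
    obtain ⟨yz, rfl, rfl⟩ := Internal.exists_pair y z
    obtain ⟨xyz, rfl, rfl⟩ := Internal.exists_pair x yz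
    obtain ⟨u, hu, rfl⟩ := Internal.exists_pair c xyz
    simpa only [Internal.map_map, map_mul_map, Internal.map_add_map, hc.map_mem_iff hu] using h u hu

theorem Codes.forall_notMem_exists_iff (hc : Codes c U) :
    (∀ x, x ∉ U → ∃ y, 1 - x * y ∈ U) ↔
      ∀ᶠ q in c.ultra, ∀ x, x ∉ q.2 → ∃ y, 1 - x * y ∈ q.2 := by
  rw [eventually_forall_iff (Y := A) (R := fun _ s x => x ∉ s → ∃ y, 1 - x * y ∈ s)]
  constructor
  · intro h u hu
    rw [Internal.eventually_imp, Internal.eventually_not]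
    intro hx
    obtain ⟨y, hy⟩ := h (Internal.map (fun _ p => p.2) u) (by rwa [hc.map_mem_iff hu])
    obtain ⟨t, rfl, rfl⟩ := Internal.exists_pair u y
    rw [Internal.map_map] at hu hy
    rw [one_eq_map A t, map_mul_map, map_sub_map, hc.map_mem_iff hu] at hy
    exact eventually_ultra_map_iff.2 (hy.mono fun q hq => ⟨_, hq⟩)
  · intro h x hx
    obtain ⟨u, hu, rfl⟩ := Internal.exists_pair c x
    rw [hc.map_mem_iff hu, ← Internal.eventually_not] at hx
    obtain ⟨g, hg⟩ := exists_eventually_of_eventually_exists (Y := A)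
      (R := fun i (p : Set (A i) × A i) y => 1 - p.2 * y ∈ p.1)
      (Internal.eventually_imp.1 (h u hu) hx)
    exact ⟨Internal.map g u, by rwa [one_eq_map A u, map_mul_map, map_sub_map, hc.map_mem_iff hu]⟩

theorem Codes.isMaximalSet_iff_eventually (hc : Codes c U) :
    IsMaximalSet U ↔ ∀ᶠ q in c.ultra, IsMaximalSet q.2 := by
  simp only [isMaximalSet_iff, Filter.eventually_and, hc.zero_mem_iff, hc.one_notMem_iff,
    hc.forall_add_mul_mem_iff, hc.forall_notMem_exists_iff]

end Codes

end NonstandardExtension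

namespace NonstandardExtension

open Internal

variable {S : NonstandardExtension.{u, v}} {I : Type u} {A : I → Type u} [∀ i, CommRing (A i)]
  {b : S.obj I} {T : I → Type u}

namespace InternalMaximal

/-- The code of an internal maximal ideal. -/
noncomputable def code (p : S.InternalMaximal A b) : S.Internal (fun i => Set (A i)) b :=
  p.2.2.choose

theorem codes_code (p : S.InternalMaximal A b) : Codes p.code (p.1 : Set (S.Internal A b)) :=
  p.2.2.choose_spec

theorem code_injective : Function.Injective (code : S.InternalMaximal A b → _) := fun p p' h =>
  Subtype.ext (Ideal.ext fun x => (p.codes_code x).trans (h ▸ (p'.codes_code x).symm))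

theorem exists_code_eq {c : S.Internal (fun i => Set (A i)) b}
    (hc : ∀ᶠ q in c.ultra, IsMaximalSet q.2) : ∃ p : S.InternalMaximal A b, p.code = c := by
  obtain ⟨P, hP, hPc⟩ := (codes_setOf c).isMaximalSet_iff_eventually.2 hc
  have hcP : Codes c (P : Set (S.Internal A b)) := hPc ▸ codes_setOf c
  let p : S.InternalMaximal A b := ⟨P, hP, c, hcP⟩
  exact ⟨p, p.codes_code.eq hcP⟩

theorem map_mem_iff (p : S.InternalMaximal A b) {w : S.Internal T b} {s : ∀ i, T i → Set (A i)}
    (hs : Internal.map s w = p.code) {f : ∀ i, T i → A i} :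
    Internal.map f w ∈ p.1 ↔ ∀ᶠ q in w.ultra, f q.1 q.2 ∈ s q.1 q.2 :=
  p.codes_code.map_mem_iff hs

theorem eventually_isMaximalSet (p : S.InternalMaximal A b) {w : S.Internal T b}
    {s : ∀ i, T i → Set (A i)} (hs : Internal.map s w = p.code) :
    ∀ᶠ q in w.ultra, IsMaximalSet (s q.1 q.2) := by
  have h := p.codes_code.isMaximalSet_iff_eventually.1 ⟨p.1, p.2.1, rfl⟩
  rw [← hs] at h
  exact eventually_ultra_map_iff.1 h

/-- The order of vanishing of `a` at `p`, the transfer of `idealOrder`. -/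
noncomputable def order (p : S.InternalMaximal A b) (a : S.Internal A b) : S.HyperInt :=
  (Internal.map₂ (fun _ a s => ULift.up (idealOrder s a : ℤ)) a p.code).toStar

theorem order_map (p : S.InternalMaximal A b) {w : S.Internal T b} {s : ∀ i, T i → Set (A i)}
    (hs : Internal.map s w = p.code) (f : ∀ i, T i → A i) : p.order (Internal.map f w) =
      (Internal.map (fun i t => ULift.up (idealOrder (s i t) (f i t) : ℤ)) w).toStar := by
  rw [order, ← hs, Internal.map₂_map_map]

theorem order_nonneg (p : S.InternalMaximal A b) (a : S.Internal A b) : 0 ≤ p.order a := by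
  obtain ⟨w, rfl, hw⟩ := Internal.exists_pair a p.code
  rw [p.order_map hw, zero_le_toStar_map_iff]
  exact .of_forall fun q => Int.natCast_nonneg _

end InternalMaximal

theorem isHyperfinite_iff_exists_code {H : Set (S.InternalMaximal A b)} : IsHyperfinite H ↔
    ∃ h : S.Internal (fun i => Finset (Set (A i))) b,
      ∀ p, p ∈ H ↔ Internal.Rel (fun _ s t => s ∈ t) p.code h := by
  refine exists_congr fun h => forall_congr' fun p => iff_congr Iff.rfl ⟨?_, ?_⟩
  · rintro ⟨c, hc, hR⟩
    rwa [p.codes_code.eq hc]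
  · exact fun hR => ⟨p.code, p.codes_code, hR⟩

theorem isHyperfinite_singleton (p : S.InternalMaximal A b) :
    IsHyperfinite ({p} : Set (S.InternalMaximal A b)) := by
  refine isHyperfinite_iff_exists_code.2 ⟨Internal.map (fun _ s => {s}) p.code, fun p' => ?_⟩
  obtain ⟨w, hp', hp⟩ := Internal.exists_pair p'.code p.code
  rw [Set.mem_singleton_iff, ← InternalMaximal.code_injective.eq_iff, ← hp', ← hp,
    Internal.map_map, rel_map_map_iff, Internal.map_eq_map_iff]
  simp only [Finset.mem_singleton]

theorem IsHyperfinite.inter {H K : Set (S.InternalMaximal A b)} (hH : IsHyperfinite H)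
    (hK : IsHyperfinite K) : IsHyperfinite (H ∩ K) := by
  classical
  rw [isHyperfinite_iff_exists_code] at hH hK ⊢
  obtain ⟨h, hh⟩ := hH
  obtain ⟨k, hk⟩ := hK
  refine ⟨Internal.map₂ (fun _ s t => s ∩ t) h k, fun p => ?_⟩
  rw [Set.mem_inter_iff, hh, hk]
  obtain ⟨t, rfl, rfl⟩ := Internal.exists_pair h k
  obtain ⟨w, rfl, hw⟩ := Internal.exists_pair t p.code
  rw [← hw]
  simp only [Internal.map_map, Internal.map₂_map_map, rel_map_map_iff, Finset.mem_inter,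
    Filter.eventually_and]

theorem isInternalFun_iff_exists_code {f : S.InternalMaximal A b → S.HyperInt} : IsInternalFun f ↔
    ∃ φ : S.Internal (fun i => Set (A i) → ULift.{u} ℤ) b,
      ∀ p, f p = (Internal.map₂ (fun _ ψ s => ψ s) φ p.code).toStar := by
  refine exists_congr fun φ => forall_congr' fun p => ?_
  exact ⟨fun h => h _ p.codes_code, fun h c hc => by rw [h, p.codes_code.eq hc]⟩

theorem exists_internalMaximal_of_not_isCoprime {x y : S.Internal A b} (h : ¬ IsCoprime x y) :
    ∃ p : S.InternalMaximal A b, x ∈ p.1 ∧ y ∈ p.1 := by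
  obtain ⟨w, rfl, rfl⟩ := Internal.exists_pair x y
  have h_not_coprime := Internal.eventually_not.2 (mt isCoprime_map_map h)
  obtain ⟨s, hs⟩ := exists_eventually_of_eventually_exists (Y := fun i => Set (A i))
    (R := fun i (p : A i × A i) s => IsMaximalSet s ∧ p.1 ∈ s ∧ p.2 ∈ s) (by
      filter_upwards [h_not_coprime] with q hq
      rw [← Ideal.isCoprime_span_singleton_iff, Ideal.isCoprime_iff_sup_eq,
        ← Ideal.span_insert] at hq
      obtain ⟨P, hP, h_le⟩ := Ideal.exists_le_maximal _ hq
      rw [Ideal.span_le, Set.insert_subset_iff, Set.singleton_subset_iff] at h_le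
      exact ⟨P, ⟨P, hP, rfl⟩, h_le⟩)
  simp only [Filter.eventually_and] at hs
  obtain ⟨p, hp⟩ := InternalMaximal.exists_code_eq (eventually_ultra_map_iff.2 hs.1)
  exact ⟨p, (p.map_mem_iff hp.symm).2 hs.2.1, (p.map_mem_iff hp.symm).2 hs.2.2⟩

namespace IsInternalDedekind

theorem eventually (hB : S.IsInternalDedekind A b) (w : S.Internal T b) :
    ∀ᶠ q in w.ultra, IsDedekindDomain (A q.1) ∧ ¬ IsField (A q.1) :=
  eventually_of_mem_ext hB w

theorem isDomain (hB : S.IsInternalDedekind A b) : IsDomain (S.Internal A b) := by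
  have : Nontrivial (S.Internal A b) := by
    let w : S.Internal (fun _ => PUnit) b := Internal.const fun _ => PUnit.unit
    refine nontrivial_of_ne 1 0 ?_
    rw [one_eq_map A w, Internal.map_ne_zero_iff]
    filter_upwards [hB.eventually w] with q ⟨_, _⟩
    exact one_ne_zero
  have : NoZeroDivisors (S.Internal A b) := ⟨fun {x y} => by
    obtain ⟨w, rfl, rfl⟩ := Internal.exists_pair x y
    contrapose!
    rintro ⟨hx, hy⟩
    rw [Internal.map_ne_zero_iff] at hx hy
    rw [map_mul_map, Internal.map_ne_zero_iff]
    filter_upwards [hB.eventually w, hx, hy] with q ⟨_, _⟩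
    exact mul_ne_zero⟩
  exact NoZeroDivisors.to_isDomain _

theorem not_isField (hB : S.IsInternalDedekind A b) : ¬ IsField (S.Internal A b) := by
  let w : S.Internal (fun _ => PUnit) b := Internal.const fun _ => PUnit.unit
  obtain ⟨x, hx⟩ := exists_eventually_of_eventually_exists (Y := A) (w := w)
    (R := fun _ _ x => x ≠ 0 ∧ ¬ IsUnit x) (by
      filter_upwards [hB.eventually w] with q ⟨_, hq⟩
      simpa only [exists_prop] using Ring.exists_not_isUnit_of_not_isField hq)
  rw [Filter.eventually_and, ← Internal.map_ne_zero_iff, Internal.eventually_not,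
    ← Internal.isUnit_map_iff] at hx
  exact fun h => hx.2 (.of_mul_eq_one _ (h.mul_inv_cancel hx.1).choose_spec)

theorem exists_add_eq_one_dvd_mul (hB : S.IsInternalDedekind A b) (x y : S.Internal A b) :
    ∃ s t, s + t = 1 ∧ y ∣ s * x ∧ x ∣ t * y := by
  obtain ⟨w, rfl, rfl⟩ := Internal.exists_pair x y
  obtain ⟨g, hg⟩ := exists_eventually_of_eventually_exists (Y := fun i => A i × A i) (w := w)
    (R := fun i p c => c.1 + c.2 = 1 ∧ p.2 ∣ c.1 * p.1 ∧ p.1 ∣ c.2 * p.2) (by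
      filter_upwards [hB.eventually w] with q ⟨_, _⟩
      simpa only [Prod.exists] using _root_.exists_add_eq_one_dvd_mul _ _)
  refine ⟨Internal.map (fun i t => (g i t).1) w, Internal.map (fun i t => (g i t).2) w, ?_⟩
  rwa [map_mul_map, map_mul_map, map_dvd_map_iff, map_dvd_map_iff, Internal.map_add_map,
    Internal.map_eq_one_iff, ← Filter.eventually_and, ← Filter.eventually_and]

theorem isHyperfinite_zeroLocus (hB : S.IsInternalDedekind A b) {a : S.Internal A b}
    (ha : a ≠ 0) : IsHyperfinite (zeroLocus a) := by
  classical
  refine isHyperfinite_iff_exists_code.2 ⟨Internal.map (fun i a =>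
    if h : {s : Set (A i) | IsMaximalSet s ∧ a ∈ s}.Finite then h.toFinset else ∅) a, fun p => ?_⟩
  obtain ⟨w, rfl, hw⟩ := Internal.exists_pair a p.code
  rw [Internal.map_ne_zero_iff] at ha
  change Internal.map _ w ∈ p.1 ↔ _
  rw [p.map_mem_iff hw, ← hw, Internal.map_map, rel_map_map_iff]
  refine Filter.eventually_congr ?_
  filter_upwards [hB.eventually w, ha, p.eventually_isMaximalSet hw] with q ⟨_, _⟩ ha hq
  rw [dif_pos (finite_setOf_isMaximalSet_mem ha), Set.Finite.mem_toFinset]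
  exact (and_iff_right hq).symm

theorem exists_forall_mem_and_one_sub_mem (hB : S.IsInternalDedekind A b) {a : S.Internal A b}
    (ha : a ≠ 0) {H : Set (S.InternalMaximal A b)} (hH : IsHyperfinite H) :
    ∃ e, ∀ p ∈ zeroLocus a, (p ∈ H → e ∈ p.1) ∧ (p ∉ H → 1 - e ∈ p.1) := by
  obtain ⟨h, hh⟩ := isHyperfinite_iff_exists_code.1 hH
  obtain ⟨w, rfl, rfl⟩ := Internal.exists_pair a h
  rw [Internal.map_ne_zero_iff] at ha
  obtain ⟨e, he⟩ := exists_eventually_of_eventually_exists (Y := A) (w := w)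
    (R := fun i c e => ∀ s, IsMaximalSet s → c.1 ∈ s → (s ∈ c.2 → e ∈ s) ∧ (s ∉ c.2 → 1 - e ∈ s))
    (by
      filter_upwards [hB.eventually w, ha] with q ⟨_, _⟩ ha
      exact exists_forall_isMaximalSet_mem_and_one_sub_mem ha {s | s ∈ q.2.2})
  refine ⟨Internal.map e w, fun p hp => ?_⟩
  obtain ⟨t, rfl, ht⟩ := Internal.exists_pair w p.code
  change Internal.map _ _ ∈ p.1 at hp
  rw [Internal.map_map, p.map_mem_iff ht] at hp
  rw [hh p, ← ht, one_eq_map A t]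
  simp only [Internal.map_map, map_sub_map, p.map_mem_iff ht, rel_map_map_iff]
  rw [← Internal.eventually_not, ← Internal.eventually_imp, ← Internal.eventually_imp,
    ← Filter.eventually_and]
  filter_upwards [eventually_ultra_map_iff.1 he, p.eventually_isMaximalSet ht, hp] with q he hs hp
  exact he _ hs hp

theorem exists_ne_zero_order_eq_add (hB : S.IsInternalDedekind A b) {a : S.Internal A b}
    (ha : a ≠ 0) {f : S.InternalMaximal A b → S.HyperInt} (hf : IsInternalFun f) :
    ∃ x y, x ≠ 0 ∧ y ≠ 0 ∧ ∀ p ∈ zeroLocus a, p.order x = f p + p.order y := by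
  obtain ⟨φ, hφ⟩ := isInternalFun_iff_exists_code.1 hf
  obtain ⟨w, rfl, rfl⟩ := Internal.exists_pair a φ
  rw [Internal.map_ne_zero_iff] at ha
  obtain ⟨g, hg⟩ := exists_eventually_of_eventually_exists (Y := fun i => A i × A i) (w := w)
    (R := fun i c x => x.1 ≠ 0 ∧ x.2 ≠ 0 ∧ ∀ s, IsMaximalSet s → c.1 ∈ s →
      ULift.up (idealOrder s x.1 : ℤ) = c.2 s + ULift.up (idealOrder s x.2 : ℤ)) (by
      filter_upwards [hB.eventually w, ha] with q ⟨_, hq⟩ ha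
      obtain ⟨x, y, hx, hy, hxy⟩ :=
        exists_forall_isMaximalSet_idealOrder_eq_add hq ha fun s => (q.2.2 s).down
      exact ⟨(x, y), hx, hy, fun s hs has => ULift.down_injective (hxy s hs has)⟩)
  simp only [Filter.eventually_and] at hg
  obtain ⟨hx, hy, hxy⟩ := hg
  refine ⟨Internal.map (fun i c => (g i c).1) w, Internal.map (fun i c => (g i c).2) w,
    Internal.map_ne_zero_iff.2 hx, Internal.map_ne_zero_iff.2 hy, fun p hp => ?_⟩
  obtain ⟨t, rfl, ht⟩ := Internal.exists_pair w p.code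
  change Internal.map _ _ ∈ p.1 at hp
  rw [Internal.map_map, p.map_mem_iff ht] at hp
  rw [hφ, ← ht]
  simp only [Internal.map_map, Internal.map₂_map_map, p.order_map ht, toStar_map_add_toStar_map,
    toStar_map_eq_iff]
  filter_upwards [eventually_ultra_map_iff.1 hxy, p.eventually_isMaximalSet ht, hp] with q hq hs hp
  exact hq _ hs hp

end IsInternalDedekind

namespace InternalMaximal

variable (p : S.InternalMaximal A b) {x y : S.Internal A b}

theorem order_mul (hB : S.IsInternalDedekind A b) (hx : x ≠ 0) (hy : y ≠ 0) :
    p.order (x * y) = p.order x + p.order y := by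
  obtain ⟨t, rfl, rfl⟩ := Internal.exists_pair x y
  obtain ⟨w, rfl, hw⟩ := Internal.exists_pair t p.code
  simp only [Internal.map_map, map_mul_map, Internal.map_ne_zero_iff] at hx hy ⊢
  rw [p.order_map hw, p.order_map hw, p.order_map hw, toStar_map_add_toStar_map, toStar_map_eq_iff]
  filter_upwards [hB.eventually w, hx, hy, p.eventually_isMaximalSet hw] with q ⟨_, hq⟩ hx hy hs
  rw [idealOrder_mul hq hs hx hy, Nat.cast_add]
  rfl

theorem order_eq_zero_iff (hB : S.IsInternalDedekind A b) : p.order x = 0 ↔ x ∉ p.1 := by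
  obtain ⟨w, rfl, hw⟩ := Internal.exists_pair x p.code
  rw [p.map_mem_iff hw, p.order_map hw, toStar_map_eq_zero_iff, ← Internal.eventually_not]
  refine Filter.eventually_congr ?_
  filter_upwards [hB.eventually w, p.eventually_isMaximalSet hw] with q ⟨_, _⟩ hs
  rw [← idealOrder_eq_zero_iff hs, ← Int.natCast_eq_zero, ← ULift.down_inj]
  rfl

end InternalMaximal

end NonstandardExtension

namespace NonstandardExtension

open Internal Filter

variable {S : NonstandardExtension.{u, v}} {I : Type u} {A : I → Type u} [∀ i, CommRing (A i)]
  {b : S.obj I}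

/-- The filter of sets of internal maximal ideals generated by the sets `V(a)` for `a ∈ m`.  The
filter on hyperfinite sets in the theorem is its trace, see `IsInternalDedekind.locusPFilter`; the
element `a = 0` is harmless since `V(0)` is the set of all internal maximal ideals. -/
def locusFilter (m : Ideal (S.Internal A b)) : Filter (S.InternalMaximal A b) :=
  ⨅ a ∈ m, 𝓟 (zeroLocus a)

variable {m : Ideal (S.Internal A b)} {a c x y : S.Internal A b}

theorem eventually_mem (hx : x ∈ m) : ∀ᶠ p in locusFilter m, x ∈ p.1 :=
  mem_iInf_of_mem x (mem_iInf_of_mem hx (mem_principal_self _))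

theorem eventually_notMem [hm : m.IsMaximal] (hx : x ∉ m) : ∀ᶠ p in locusFilter m, x ∉ p.1 := by
  obtain ⟨y, i, hi, h⟩ := hm.exists_inv hx
  filter_upwards [eventually_mem hi] with p hip hxp
  exact p.1.ne_top_iff_one.1 p.2.1.ne_top (h ▸ p.1.add_mem (p.1.mul_mem_left y hxp) hip)

namespace IsInternalDedekind

theorem exists_mem_ne_zero (hB : S.IsInternalDedekind A b) (m : Ideal (S.Internal A b))
    [hm : m.IsMaximal] : ∃ c ∈ m, c ≠ 0 :=
  have := hB.isDomain
  Submodule.exists_mem_ne_zero_of_ne_bot (Ring.ne_bot_of_isMaximal_of_not_isField hm hB.not_isField)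

theorem isHyperfinite_zeroLocus_inter (hB : S.IsInternalDedekind A b) (hc : c ≠ 0)
    (x : S.Internal A b) : IsHyperfinite (zeroLocus c ∩ zeroLocus x) := by
  obtain rfl | hx := eq_or_ne x 0
  · rw [Set.inter_eq_left.2 fun p _ => p.1.zero_mem]
    exact hB.isHyperfinite_zeroLocus hc
  · exact (hB.isHyperfinite_zeroLocus hc).inter (hB.isHyperfinite_zeroLocus hx)

theorem exists_mem_zeroLocus_inter_subset (hB : S.IsInternalDedekind A b) (hc : c ≠ 0) (hx : x ∈ m)
    (hy : y ∈ m) :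
    ∃ z ∈ m, zeroLocus c ∩ zeroLocus z ⊆ zeroLocus x ∩ zeroLocus y := by
  obtain ⟨e, he⟩ :=
    hB.exists_forall_mem_and_one_sub_mem hc (hB.isHyperfinite_zeroLocus_inter hc x)
  refine ⟨x + (1 - e) * y, m.add_mem hx (m.mul_mem_left _ hy), ?_⟩
  rintro p ⟨hcp, hzp : x + (1 - e) * y ∈ p.1⟩
  obtain ⟨he_mem, he_one_sub⟩ := he p hcp
  have hxp : x ∈ p.1 := by
    by_contra hxp
    have h_mul := p.1.mul_mem_right y (he_one_sub fun h => hxp h.2)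
    exact hxp ((p.1.add_mem_iff_left h_mul).1 hzp)
  have h_mul := (p.1.add_mem_iff_right hxp).1 hzp
  exact ⟨hxp, (p.2.1.isPrime.mem_or_mem h_mul).resolve_left
    (one_sub_notMem_of_mem p.2.1.ne_top (he_mem ⟨hcp, hxp⟩))⟩

theorem hasBasis_locusFilter (hB : S.IsInternalDedekind A b) (hc : c ∈ m) (hc0 : c ≠ 0) :
    (locusFilter m).HasBasis (· ∈ m) fun x => zeroLocus c ∩ zeroLocus x := by
  have h_eq : locusFilter m = ⨅ x ∈ (m : Set (S.Internal A b)), 𝓟 (zeroLocus c ∩ zeroLocus x) :=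
    le_antisymm
      (le_iInf₂ fun x hx => le_principal_iff.2 (inter_mem (eventually_mem hc) (eventually_mem hx)))
      (le_iInf₂ fun x hx => iInf₂_le_of_le x hx (principal_mono.2 Set.inter_subset_right))
  rw [h_eq]
  refine hasBasis_biInf_principal (fun x hx y hy => ?_) ⟨0, m.zero_mem⟩
  obtain ⟨z, hz, h_sub⟩ := hB.exists_mem_zeroLocus_inter_subset hc0 hx hy
  exact ⟨z, hz, fun p hp => ⟨hp.1, (h_sub hp).1⟩, fun p hp => ⟨hp.1, (h_sub hp).2⟩⟩

variable (m) in
theorem neBot_locusFilter (hB : S.IsInternalDedekind A b) [hm : m.IsMaximal] :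
    (locusFilter m).NeBot := by
  obtain ⟨c, hc, hc0⟩ := hB.exists_mem_ne_zero m
  refine (hB.hasBasis_locusFilter hc hc0).neBot_iff.2 fun {x} hx =>
    exists_internalMaximal_of_not_isCoprime ?_
  rintro ⟨s, t, hst⟩
  exact m.ne_top_iff_one.1 hm.ne_top (hst ▸ m.add_mem (m.mul_mem_left s hc) (m.mul_mem_left t hx))

theorem mem_or_compl_mem_locusFilter (hB : S.IsInternalDedekind A b) [m.IsMaximal]
    {H : Set (S.InternalMaximal A b)} (hH : IsHyperfinite H) :
    H ∈ locusFilter m ∨ Hᶜ ∈ locusFilter m := by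
  obtain ⟨c, hc, hc0⟩ := hB.exists_mem_ne_zero m
  obtain ⟨e, he⟩ := hB.exists_forall_mem_and_one_sub_mem hc0 hH
  by_cases hem : e ∈ m
  · left
    filter_upwards [eventually_mem hc, eventually_mem hem] with p hcp hep
    by_contra hpH
    exact one_sub_notMem_of_mem p.2.1.ne_top hep ((he p hcp).2 hpH)
  · right
    filter_upwards [eventually_mem hc, eventually_notMem hem] with p hcp hep hpH
    exact hep ((he p hcp).1 hpH)

theorem locusFilter_eq_pure (hB : S.IsInternalDedekind A b) [hm : m.IsMaximal]
    (h_internal : IsInternal (m : Set (S.Internal A b))) :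
    locusFilter m = pure ⟨m, hm, h_internal⟩ := by
  have := hB.neBot_locusFilter m
  have h_le : pure ⟨m, hm, h_internal⟩ ≤ locusFilter m :=
    le_iInf₂ fun a ha => le_principal_iff.2 ha
  refine le_antisymm (le_pure_iff.2 ?_) h_le
  exact (hB.mem_or_compl_mem_locusFilter (isHyperfinite_singleton _)).resolve_right fun h =>
    h_le h rfl

/-- The filter on the lattice of hyperfinite sets generated by the sets `V(a)` for nonzero
`a ∈ m`. -/
def locusPFilter (hB : S.IsInternalDedekind A b) (m : Ideal (S.Internal A b)) [m.IsMaximal] :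
    Order.PFilter (S.HyperfiniteSets A b) :=
  Order.IsPFilter.toPFilter (F := {H | H.1 ∈ locusFilter m}) <| by
    obtain ⟨c, hc, hc0⟩ := hB.exists_mem_ne_zero m
    exact .of_def ⟨⟨zeroLocus c, hB.isHyperfinite_zeroLocus hc0⟩, eventually_mem hc⟩
      (fun H hH K hK => ⟨⟨H.1 ∩ K.1, H.2.inter K.2⟩, inter_mem (f := locusFilter m) hH hK,
        Set.inter_subset_left, Set.inter_subset_right⟩)
      fun {_ _} h hH => mem_of_superset (f := locusFilter m) hH h

variable [m.IsMaximal]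

theorem mem_locusPFilter_iff (hB : S.IsInternalDedekind A b) {H : S.HyperfiniteSets A b} :
    H ∈ hB.locusPFilter m ↔ H.1 ∈ locusFilter m := Iff.rfl

theorem mem_locusPFilter_iff_of_isInternal (hB : S.IsInternalDedekind A b)
    (h_internal : IsInternal (m : Set (S.Internal A b))) {H : S.HyperfiniteSets A b} :
    H ∈ hB.locusPFilter m ↔ ⟨m, inferInstance, h_internal⟩ ∈ H.1 := by
  rw [mem_locusPFilter_iff, hB.locusFilter_eq_pure h_internal]
  exact mem_pure

theorem exists_mem_locusPFilter_iff (hB : S.IsInternalDedekind A b)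
    {P : S.InternalMaximal A b → Prop} :
    (∃ H ∈ hB.locusPFilter m, ∀ p ∈ H.1, P p) ↔ ∀ᶠ p in locusFilter m, P p := by
  refine ⟨fun ⟨H, hH, h⟩ => mem_of_superset hH h, fun h => ?_⟩
  obtain ⟨c, hc, hc0⟩ := hB.exists_mem_ne_zero m
  obtain ⟨x, hx, h_sub⟩ := (hB.hasBasis_locusFilter hc hc0).mem_iff.1 h
  exact ⟨⟨_, hB.isHyperfinite_zeroLocus_inter hc0 x⟩,
    (hB.hasBasis_locusFilter hc hc0).mem_of_mem hx, h_sub⟩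

theorem mem_locusPFilter_iff_exists_finset (hB : S.IsInternalDedekind A b)
    {H : S.HyperfiniteSets A b} : H ∈ hB.locusPFilter m ↔ ∃ t : Finset (S.Internal A b),
      t.Nonempty ∧ (∀ a ∈ t, a ∈ m ∧ a ≠ 0) ∧ ⋂ a ∈ t, zeroLocus a ⊆ H.1 := by
  classical
  rw [mem_locusPFilter_iff]
  constructor
  · intro hH
    obtain ⟨c, hc, hc0⟩ := hB.exists_mem_ne_zero m
    obtain ⟨x, hx, h_sub⟩ := (hB.hasBasis_locusFilter hc hc0).mem_iff.1 hH
    obtain rfl | hx0 := eq_or_ne x 0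
    · refine ⟨{c}, by simp, by simp [hc, hc0], fun p hp => h_sub ⟨?_, p.1.zero_mem⟩⟩
      simpa using hp
    · exact ⟨{c, x}, by simp, by simp [hc, hc0, hx, hx0], by simpa using h_sub⟩
  · rintro ⟨t, -, ht, h_sub⟩
    exact mem_of_superset ((biInter_finset_mem t).2 fun a ha => eventually_mem (ht a ha).1) h_sub

theorem isUltrafilterOf_locusPFilter (hB : S.IsInternalDedekind A b) :
    IsUltrafilterOf m (hB.locusPFilter m) := by
  have := hB.neBot_locusFilter m
  have h_proper : (hB.locusPFilter m).dual.IsProper :=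
    Order.Ideal.isProper_of_notMem (p := .toDual ⟨∅, isHyperfinite_empty⟩)
      (empty_notMem (locusFilter m))
  refine ⟨⟨fun J hJ => Set.eq_univ_of_forall fun K => ?_⟩,
    fun H => hB.mem_locusPFilter_iff_exists_finset⟩
  obtain ⟨H, hHJ, hH : H.ofDual.1 ∉ locusFilter m⟩ := SetLike.exists_of_lt hJ
  have h_compl := (hB.mem_or_compl_mem_locusFilter H.ofDual.2).resolve_left hH
  obtain ⟨H', hH', h_disjoint⟩ := hB.exists_mem_locusPFilter_iff.2 h_compl
  obtain ⟨W, hWJ, hWH, hWH'⟩ := J.directed _ hHJ (.toDual H') (hJ.le hH')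
  exact J.lower (fun p hp => (h_disjoint p (hWH' hp) (hWH hp)).elim) hWJ

end IsInternalDedekind

end NonstandardExtension

namespace NonstandardExtension

open Internal Filter

open scoped nonZeroDivisors

variable {S : NonstandardExtension.{u, v}} {I : Type u} {A : I → Type u} [∀ i, CommRing (A i)]
  {b : S.obj I}

namespace DivisorsMod

variable {𝓕 : Order.PFilter (S.HyperfiniteSets A b)}

theorem mk_surjective : Function.Surjective (mk : S.weilDivisors A b → DivisorsMod 𝓕) :=
  QuotientAddGroup.mk_surjective

theorem mk_add (f g : S.weilDivisors A b) : (mk (f + g) : DivisorsMod 𝓕) = mk f + mk g := rfl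

theorem mk_le_mk_iff {f g : S.weilDivisors A b} :
    (mk f : DivisorsMod 𝓕) ≤ mk g ↔ ∃ H ∈ 𝓕, ∀ p ∈ H.1, f.1 p ≤ g.1 p := by
  refine ⟨?_, fun h => ⟨f, g, rfl, rfl, h⟩⟩
  rintro ⟨f', g', hf, hg, H, hH, h⟩
  obtain ⟨K, hK, hf⟩ := (mk_eq_mk_iff _ _).1 hf
  obtain ⟨J, hJ, hg⟩ := (mk_eq_mk_iff _ _).1 hg
  obtain ⟨M, hM, hMH, hMK⟩ := 𝓕.directed H hH K hK
  obtain ⟨N, hN, hNM, hNJ⟩ := 𝓕.directed M hM J hJ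
  refine ⟨N, hN, fun p hp => ?_⟩
  rw [← hf p (hMK (hNM hp)), ← hg p (hNJ hp)]
  exact h p (hMH (hNM hp))

instance : PartialOrder (DivisorsMod 𝓕) where
  le_antisymm x y hxy hyx := by
    obtain ⟨f, rfl⟩ := mk_surjective x
    obtain ⟨g, rfl⟩ := mk_surjective y
    obtain ⟨H, hH, hfg⟩ := mk_le_mk_iff.1 hxy
    obtain ⟨K, hK, hgf⟩ := mk_le_mk_iff.1 hyx
    obtain ⟨J, hJ, hJH, hJK⟩ := 𝓕.directed H hH K hK
    exact (mk_eq_mk_iff _ _).2 ⟨J, hJ, fun p hp => (hfg p (hJH hp)).antisymm (hgf p (hJK hp))⟩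

instance : IsOrderedAddMonoid (DivisorsMod 𝓕) where
  add_le_add_left x y h z := by
    obtain ⟨f, rfl⟩ := mk_surjective x
    obtain ⟨g, rfl⟩ := mk_surjective y
    obtain ⟨k, rfl⟩ := mk_surjective z
    obtain ⟨H, hH, h⟩ := mk_le_mk_iff.1 h
    exact mk_le_mk_iff.2 ⟨H, hH, fun p hp => add_le_add_left (h p hp) _⟩

end DivisorsMod

theorem isInternalFun_const (z : S.HyperInt) :
    IsInternalFun fun _ : S.InternalMaximal A b => z := by
  obtain ⟨y, rfl⟩ := toStar_surjective (b := b) z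
  refine isInternalFun_iff_exists_code.2 ⟨Internal.map (fun _ z _ => z) y, fun p => ?_⟩
  obtain ⟨w, rfl, hw⟩ := Internal.exists_pair y p.code
  rw [← hw, Internal.map_map, Internal.map₂_map_map]

theorem isInternalFun_order (a : S.Internal A b) :
    IsInternalFun fun p : S.InternalMaximal A b => p.order a := by
  refine isInternalFun_iff_exists_code.2
    ⟨Internal.map (fun _ a s => ULift.up (idealOrder s a : ℤ)) a, fun p => ?_⟩
  obtain ⟨w, rfl, hw⟩ := Internal.exists_pair a p.code
  rw [p.order_map hw, ← hw, Internal.map_map, Internal.map₂_map_map]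

theorem InternalMaximal.order_pos_of_mem (p : S.InternalMaximal A b)
    (hB : S.IsInternalDedekind A b) {x : S.Internal A b} (hx : x ∈ p.1) : 0 < p.order x :=
  (p.order_nonneg x).lt_of_ne' fun h => (p.order_eq_zero_iff hB).1 h hx

namespace IsInternalDedekind

variable {m : Ideal (S.Internal A b)} [m.IsMaximal]

theorem exists_notMem_dvd_mul_of_eventually_order_le (hB : S.IsInternalDedekind A b)
    {x y : S.Internal A b} (hx : x ≠ 0) (hy : y ≠ 0)
    (h : ∀ᶠ p in locusFilter m, p.order x ≤ p.order y) : ∃ t ∉ m, x ∣ t * y := by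
  have := hB.isDomain
  have := hB.neBot_locusFilter m
  obtain ⟨s, t, hst, ⟨d, hd⟩, ht⟩ := hB.exists_add_eq_one_dvd_mul x y
  by_contra! h_dvd
  have htm : t ∈ m := by_contra fun htm => h_dvd t htm ht
  have hdm : d ∈ m := by_contra fun hdm => h_dvd d hdm ⟨s, by rw [mul_comm, ← hd, mul_comm]⟩
  have hsm : s ∉ m := fun hsm =>
    m.ne_top_iff_one.1 Ideal.IsPrime.ne_top' (hst ▸ m.add_mem hsm htm)
  obtain ⟨p, h_le, hsp, hdp⟩ :=
    (h.and ((eventually_notMem hsm).and (eventually_mem hdm))).exists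
  have hs0 : s ≠ 0 := fun hs => hsp (hs ▸ p.1.zero_mem)
  have hd0 : d ≠ 0 := right_ne_zero_of_mul (hd ▸ mul_ne_zero hs0 hx)
  have h_order : p.order x = p.order y + p.order d := by
    rw [← p.order_mul hB hy hd0, ← hd, p.order_mul hB hs0 hx, (p.order_eq_zero_iff hB).2 hsp,
      zero_add]
  exact h_le.not_gt (h_order ▸ lt_add_of_pos_right _ (p.order_pos_of_mem hB hdp))

theorem eventually_order_le_iff (hB : S.IsInternalDedekind A b) {x y : S.Internal A b}
    (hx : x ≠ 0) (hy : y ≠ 0) :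
    (∀ᶠ p in locusFilter m, p.order x ≤ p.order y) ↔ ∃ t ∉ m, x ∣ t * y := by
  refine ⟨hB.exists_notMem_dvd_mul_of_eventually_order_le hx hy, ?_⟩
  rintro ⟨t, ht, d, hd⟩
  have := hB.isDomain
  have ht0 : t ≠ 0 := fun h => ht (h ▸ m.zero_mem)
  have hd0 : d ≠ 0 := right_ne_zero_of_mul (hd ▸ mul_ne_zero ht0 hy)
  filter_upwards [eventually_notMem ht] with p htp
  calc p.order x ≤ p.order x + p.order d := le_add_of_nonneg_right (p.order_nonneg d)
    _ = p.order t + p.order y := by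
      rw [← p.order_mul hB hx hd0, ← hd, p.order_mul hB ht0 hy]
    _ = p.order y := by rw [(p.order_eq_zero_iff hB).2 htp, zero_add]

theorem order_mem_weilDivisors (hB : S.IsInternalDedekind A b) {a : S.Internal A b} (ha : a ≠ 0) :
    (fun p : S.InternalMaximal A b => p.order a) ∈ S.weilDivisors A b :=
  ⟨isInternalFun_order a, zeroLocus a, hB.isHyperfinite_zeroLocus ha,
    fun p => (p.order_eq_zero_iff hB).2⟩

/-- The internal principal divisor of a nonzero element: its order of vanishing at every internal
maximal ideal. -/
noncomputable def principalDivisor (hB : S.IsInternalDedekind A b) [Nontrivial (S.Internal A b)] :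
    Additive (S.Internal A b)⁰ →+ S.weilDivisors A b :=
  .mk' (fun x => ⟨_, hB.order_mem_weilDivisors (nonZeroDivisors.ne_zero x.toMul.2)⟩) fun x y =>
    Subtype.ext <| funext fun p => p.order_mul hB (nonZeroDivisors.ne_zero x.toMul.2)
      (nonZeroDivisors.ne_zero y.toMul.2)

variable (m) in
theorem isDomain_localization (hB : S.IsInternalDedekind A b) : IsDomain (Localization.AtPrime m) :=
  have := hB.isDomain
  IsLocalization.isDomain_localization m.primeCompl_le_nonZeroDivisors

variable [IsDomain (Localization.AtPrime m)]

variable (m) in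
theorem valuationRing_localization (hB : S.IsInternalDedekind A b) :
    ValuationRing (Localization.AtPrime m) :=
  valuationRing_of_exists_add_eq_one_dvd_mul m hB.exists_add_eq_one_dvd_mul

variable [ValuationRing (Localization.AtPrime m)] {L : Type*} [Field L]
  [Algebra (Localization.AtPrime m) L] [IsFractionRing (Localization.AtPrime m) L]

theorem nonempty_orderAddIso_divisorsMod (hB : S.IsInternalDedekind A b) :
    Nonempty (AddValueGroup (Localization.AtPrime m) L ≃+o DivisorsMod (hB.locusPFilter m)) := by
  have := hB.isDomain
  refine nonempty_addValueGroup_orderAddIso m.primeCompl m.primeCompl_le_nonZeroDivisors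
    ((AddMonoidHom.mk' DivisorsMod.mk DivisorsMod.mk_add).comp hB.principalDivisor)
    (fun x y => ?_) fun γ => ?_
  · exact DivisorsMod.mk_le_mk_iff.trans <| hB.exists_mem_locusPFilter_iff.trans <|
      hB.eventually_order_le_iff (nonZeroDivisors.ne_zero x.2) (nonZeroDivisors.ne_zero y.2)
  · obtain ⟨f, rfl⟩ := DivisorsMod.mk_surjective γ
    obtain ⟨c, hc, hc0⟩ := hB.exists_mem_ne_zero m
    obtain ⟨x, y, hx, hy, hxy⟩ := hB.exists_ne_zero_order_eq_add hc0 f.2.1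
    refine ⟨.ofMul ⟨x, mem_nonZeroDivisors_of_ne_zero hx⟩,
      .ofMul ⟨y, mem_nonZeroDivisors_of_ne_zero hy⟩, sub_eq_of_eq_add ?_⟩
    refine (DivisorsMod.mk_eq_mk_iff _ (f + _)).2 (hB.exists_mem_locusPFilter_iff.2 ?_)
    exact (eventually_mem hc).mono hxy

theorem nonempty_orderAddIso_hyperInt (hB : S.IsInternalDedekind A b)
    (h_internal : IsInternal (m : Set (S.Internal A b))) :
    Nonempty (AddValueGroup (Localization.AtPrime m) L ≃+o S.HyperInt) := by
  have := hB.isDomain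
  let p : S.InternalMaximal A b := ⟨m, inferInstance, h_internal⟩
  refine nonempty_addValueGroup_orderAddIso m.primeCompl m.primeCompl_le_nonZeroDivisors
    ((Pi.evalAddMonoidHom _ p).comp ((S.weilDivisors A b).subtype.comp hB.principalDivisor))
    (fun x y => ?_) fun z => ?_
  · change p.order x ≤ p.order y ↔ ∃ t ∉ m, _
    rw [← hB.eventually_order_le_iff (nonZeroDivisors.ne_zero x.2) (nonZeroDivisors.ne_zero y.2),
      hB.locusFilter_eq_pure h_internal]
    exact eventually_pure.symm
  · obtain ⟨c, hc, hc0⟩ := hB.exists_mem_ne_zero m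
    obtain ⟨x, y, hx, hy, hxy⟩ := hB.exists_ne_zero_order_eq_add hc0 (isInternalFun_const z)
    exact ⟨.ofMul ⟨x, mem_nonZeroDivisors_of_ne_zero hx⟩,
      .ofMul ⟨y, mem_nonZeroDivisors_of_ne_zero hy⟩, sub_eq_of_eq_add (hxy p hc)⟩

end IsInternalDedekind

end NonstandardExtension

theorem mainTheorem5 (S : NonstandardExtension.{u, v}) {I : Type u} (A : I → Type u)
    [∀ i, CommRing (A i)] (b : S.obj I) (hB : S.IsInternalDedekind A b)
    (m : Ideal (S.Internal A b)) [m.IsMaximal]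
    (L : Type*) [Field L] [Algebra (Localization.AtPrime m) L]
    [IsFractionRing (Localization.AtPrime m) L] :
    ∃ (_ : IsDomain (Localization.AtPrime m)) (_ : ValuationRing (Localization.AtPrime m))
      (𝓕 : Order.PFilter (S.HyperfiniteSets A b)),
      NonstandardExtension.IsUltrafilterOf m 𝓕 ∧
      Nonempty (AddValueGroup (Localization.AtPrime m) L ≃+o
        NonstandardExtension.DivisorsMod 𝓕) ∧
      ∀ hm : NonstandardExtension.IsInternal (m : Set (S.Internal A b)),
        (∀ H : S.HyperfiniteSets A b, H ∈ 𝓕 ↔ ⟨m, inferInstance, hm⟩ ∈ H.1) ∧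
        Nonempty (AddValueGroup (Localization.AtPrime m) L ≃+o S.HyperInt) := by
  have h_domain := hB.isDomain_localization m
  have h_valuation := hB.valuationRing_localization m
  exact ⟨h_domain, h_valuation, hB.locusPFilter m, hB.isUltrafilterOf_locusPFilter,
    hB.nonempty_orderAddIso_divisorsMod, fun h_internal =>
      ⟨fun _ => hB.mem_locusPFilter_iff_of_isInternal h_internal,
        hB.nonempty_orderAddIso_hyperInt h_internal⟩⟩
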